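/- Let $M^2$ be a smooth ($C^\infty$) $2$-manifold and let $d\sigma^2=\langle\cdot,\cdot\rangle$ be a smooth positive semi-definite metric on an open subset $W$ of $M^2$ (for instance $W=M^2$). A point of $W$ is singular if $d\sigma^2$ is not positive definite there, and $\mathcal N_p=\{v\in T_pM^2 : \langle v,w\rangle=0 \text{ for all } w\in T_pM^2\}$. For smooth vector fields put $$\Gamma(X,Y,Z)=\tfrac12\bigl(X\langle Y,Z\rangle+Y\langle X,Z\rangle-Z\langle X,Y\rangle+\langle[X,Y],Z\rangle-\langle[X,Z],Y\rangle-\langle[Y,Z],X\rangle\bigr).$$ The metric is *admissible* if, at each singular point $p$, $\Gamma(X,Y,Z)(p)=0$ for all smooth vector fields $X,Y,Z$ with $Z_p\in\mathcal N_p$. It is a *frontal metric* if it is admissible and, writing $d\sigma^2=E\,du^2+2F\,du\,dv+G\,dv^2$ in any local coordinate system $(u,v)$, near each point of the coordinate domain there is a $C^\infty$ function $\lambda$ with $EG-F^2=\lambda^2$. A singular point $p$ is *non-degenerate* if $d\lambda\neq0$ at $p$, and a *Kossowski metric* is a frontal metric all of whose singular points are non-degenerate. Near a non-degenerate singular point $p$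 of a Kossowski metric the singular set is a regular curve $\gamma(t)$ with $\gamma(0)=p$; let $\eta(t)$ be a smooth non-vanishing vector field along $\gamma$ with $\eta(t)\in\mathcal N_{\gamma(t)}$. The point $p$ is an *$A_2$-point* if $\dot\gamma(0)$ and $\eta(0)$ are linearly independent. **Proposition.** (1) Let $p\in W$ be an $A_2$-point of a Kossowski metric $d\sigma^2$ on $W$. Then there exist a local coordinate system $(u,v)$ centered at $p$ and $C^\infty$ functions $\alpha,\beta$ on its domain such that there $$d\sigma^2=(1+v^2\alpha)\,du^2+v^2(1+v\beta)\,dv^2.\qquad(*)$$ (2) Conversely, let $\alpha,\beta$ be $C^\infty$ functions on an open neighbourhood $U$ of the origin of the $(u,v)$-plane. Then there is an open neighbourhood $W\subseteq U$ of the origin on which $(*)$ is a Kossowski metric, and the origin is an $A_2$-point of it. -/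

import Mathlib

open scoped Manifold ContDiff Topology

noncomputable section

/-- The Euclidean plane, the model space of `2`-manifolds; the coordinates of a point `y` are
`u = y 0` and `v = y 1`. -/
abbrev Plane : Type := EuclideanSpace ℝ (Fin 2)

namespace Kossowski

/-- A field of bilinear forms on the tangent spaces of a `2`-manifold. -/
abbrev BilinField (M : Type*) [TopologicalSpace M] [ChartedSpace Plane M] : Type _ :=
  ∀ x : M, TangentSpace (𝓡 2) x →L[ℝ] TangentSpace (𝓡 2) x →L[ℝ] ℝ

section Defs

variable {M : Type*} [TopologicalSpace M] [ChartedSpace Plane M] [IsManifold (𝓡 2) ∞ M]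

/-- `g` is a (smooth) positive semi-definite metric on the set `W`. -/
structure IsSemiMetricOn (g : BilinField M) (W : Set M) : Prop where
  smooth : ContMDiffOn (𝓡 2) ((𝓡 2).prod 𝓘(ℝ, Plane →L[ℝ] Plane →L[ℝ] ℝ)) ∞
    (fun x : M => Bundle.TotalSpace.mk' (Plane →L[ℝ] Plane →L[ℝ] ℝ)
      (E := fun y : M => TangentSpace (𝓡 2) y →L[ℝ] TangentSpace (𝓡 2) y →L[ℝ] ℝ) x (g x)) W
  symm : ∀ x ∈ W, ∀ X Y : TangentSpace (𝓡 2) x, g x X Y = g x Y X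
  nonneg : ∀ x ∈ W, ∀ X : TangentSpace (𝓡 2) x, 0 ≤ g x X X

/-- A singular point: the metric is not positive definite there. -/
def IsSingular (g : BilinField M) (p : M) : Prop :=
  ¬ ∀ X : TangentSpace (𝓡 2) p, X ≠ 0 → 0 < g p X X

/-- The null space (radical) of the metric at `p`. -/
def nullSpace (g : BilinField M) (p : M) : Submodule ℝ (TangentSpace (𝓡 2) p) where
  carrier := {X | ∀ Y : TangentSpace (𝓡 2) p, g p X Y = 0}
  add_mem' := by
    intro a b ha hb Y
    simp [ha Y, hb Y]
  zero_mem' := by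
    intro Y
    simp
  smul_mem' := by
    intro c a ha Y
    simp [ha Y]

/-- `X` is a smooth vector field on the set `W`. -/
def IsVectorFieldOn (X : ∀ x : M, TangentSpace (𝓡 2) x) (W : Set M) : Prop :=
  ContMDiffOn (𝓡 2) (𝓡 2).tangent ∞
    (fun x : M => (⟨x, X x⟩ : TangentBundle (𝓡 2) M)) W

/-- The derivative `(X φ)(p)` of the function `φ` along the vector field `X`. -/
def dirDeriv (X : ∀ x : M, TangentSpace (𝓡 2) x) (φ : M → ℝ) (p : M) : ℝ :=
  (mfderiv (𝓡 2) 𝓘(ℝ, ℝ) φ p : TangentSpace (𝓡 2) p →L[ℝ] ℝ) (X p)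

/-- The Kossowski pseudo-connection `Γ(X, Y, Z)`, at the point `p`. -/
def pseudoConnection (g : BilinField M) (X Y Z : ∀ x : M, TangentSpace (𝓡 2) x) (p : M) : ℝ :=
  (1 / 2) *
    (dirDeriv X (fun x => g x (Y x) (Z x)) p
      + dirDeriv Y (fun x => g x (X x) (Z x)) p
      - dirDeriv Z (fun x => g x (X x) (Y x)) p
      + g p (VectorField.mlieBracket (𝓡 2) X Y p) (Z p)
      - g p (VectorField.mlieBracket (𝓡 2) X Z p) (Y p)
      - g p (VectorField.mlieBracket (𝓡 2) Y Z p) (X p))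

/-- Admissibility of a point `p` of `W`: the trilinear map induced by `Γ` on
`T_p × T_p × N_p` vanishes. -/
def IsAdmissibleAt (g : BilinField M) (W : Set M) (p : M) : Prop :=
  ∀ X Y Z : ∀ x : M, TangentSpace (𝓡 2) x,
    IsVectorFieldOn X W → IsVectorFieldOn Y W → IsVectorFieldOn Z W →
      Z p ∈ nullSpace g p → pseudoConnection g X Y Z p = 0

/-- `g` is an admissible metric on `W`. -/
def IsAdmissibleOn (g : BilinField M) (W : Set M) : Prop :=
  IsSemiMetricOn g W ∧ ∀ p ∈ W, IsSingular g p → IsAdmissibleAt g W p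

/-- The `i`-th coordinate vector field of the chart `e`, at the point with coordinates `y`. -/
def coordField (e : OpenPartialHomeomorph M Plane) (i : Fin 2) (y : Plane) :
    TangentSpace (𝓡 2) (e.symm y) :=
  mfderiv (𝓡 2) (𝓡 2) e.symm y (EuclideanSpace.single i (1 : ℝ) : Plane)

/-- The coefficients of the metric in the chart `e`, as functions of the coordinates:
`E = coeff g e 0 0`, `F = coeff g e 0 1`, `G = coeff g e 1 1`. -/
def coeff (g : BilinField M) (e : OpenPartialHomeomorph M Plane) (i j : Fin 2) (y : Plane) : ℝ :=
  g (e.symm y) (coordField e i y) (coordField e j y)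

/-- `lam` is a smooth function on the set `V` of coordinates with `E G - F ^ 2 = lam ^ 2`. -/
def IsAreaDensityOn (g : BilinField M) (e : OpenPartialHomeomorph M Plane) (V : Set Plane)
    (lam : Plane → ℝ) : Prop :=
  ContDiffOn ℝ ∞ lam V ∧
    ∀ y ∈ V, coeff g e 0 0 y * coeff g e 1 1 y - coeff g e 0 1 y ^ 2 = lam y ^ 2

/-- `g` is a frontal metric on `W`: it is admissible and, in every local coordinate system,
`E G - F ^ 2` is locally the square of a smooth function. -/
def IsFrontalOn (g : BilinField M) (W : Set M) : Prop :=
  IsAdmissibleOn g W ∧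
    ∀ e ∈ IsManifold.maximalAtlas (𝓡 2) ∞ M, ∀ p ∈ e.source ∩ W,
      ∃ V : Set Plane, IsOpen V ∧ e p ∈ V ∧ V ⊆ e.target ∧ ∃ lam, IsAreaDensityOn g e V lam

/-- The point `p` is non-degenerate: `d lam ≠ 0` at `p`, where `lam ^ 2 = E G - F ^ 2` near `p`.
(For a singular point this depends neither on the chart nor on the choice of `lam`.) -/
def IsNondegenerateAt (g : BilinField M) (p : M) : Prop :=
  ∃ e ∈ IsManifold.maximalAtlas (𝓡 2) ∞ M, p ∈ e.source ∧
    ∃ V : Set Plane, IsOpen V ∧ e p ∈ V ∧ V ⊆ e.target ∧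
      ∃ lam, IsAreaDensityOn g e V lam ∧ fderiv ℝ lam (e p) ≠ 0

/-- `g` is a Kossowski metric on `W`: a frontal metric all of whose singular points are
non-degenerate. -/
def IsKossowskiOn (g : BilinField M) (W : Set M) : Prop :=
  IsFrontalOn g W ∧ ∀ p ∈ W, IsSingular g p → IsNondegenerateAt g p

/-- `p` is an `A₂`-point: a non-degenerate singular point such that, in a local coordinate system
`e` at `p`, the singular set near `p` is parametrized by a regular curve `γ` with `γ 0 = e p`,
and a smooth non-vanishing null vector field `η` along `γ` is transversal to `γ` at `p`. -/
def IsA2Point (g : BilinField M) (p : M) : Prop :=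
  IsSingular g p ∧ IsNondegenerateAt g p ∧
    ∃ e ∈ IsManifold.maximalAtlas (𝓡 2) ∞ M, p ∈ e.source ∧
      ∃ (ε : ℝ) (γ η : ℝ → Plane), 0 < ε ∧
        ContDiffOn ℝ ∞ γ (Set.Ioo (-ε) ε) ∧ ContDiffOn ℝ ∞ η (Set.Ioo (-ε) ε) ∧
        γ 0 = e p ∧
        (∀ t ∈ Set.Ioo (-ε) ε, γ t ∈ e.target ∧ IsSingular g (e.symm (γ t)) ∧ deriv γ t ≠ 0) ∧
        (∀ᶠ y in 𝓝 (e p), IsSingular g (e.symm y) → ∃ t ∈ Set.Ioo (-ε) ε, γ t = y) ∧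
        (∀ t ∈ Set.Ioo (-ε) ε, η t ≠ 0 ∧
          mfderiv (𝓡 2) (𝓡 2) e.symm (γ t) (η t : Plane) ∈ nullSpace g (e.symm (γ t))) ∧
        LinearIndependent ℝ ![deriv γ 0, η 0]

end Defs

/-- The coordinate differential `du` (for `i = 0`) or `dv` (for `i = 1`) of the plane. -/
def coordForm (i : Fin 2) : Plane →L[ℝ] ℝ := EuclideanSpace.proj i

/-- The metric `(1 + v² α) du² + v² (1 + v β) dv²` on the plane. -/
def normalForm (α β : Plane → ℝ) : BilinField Plane := fun y =>
  (((1 + y 1 ^ 2 * α y) • (coordForm 0).smulRight (coordForm 0)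
    + (y 1 ^ 2 * (1 + y 1 * β y)) • (coordForm 1).smulRight (coordForm 1) :
      Plane →L[ℝ] Plane →L[ℝ] ℝ))

end Kossowski

end

/-!
Both directions rest on a local description of the metric in the coordinate plane.

*Existence of the normal form.* Let `γ` be the singular curve and `η` the null field along it in
some chart at the `A₂`-point `p`. As `γ` and `η` are transversal, `(s, y) ↦ γ s + y • η s` is a
local parametrization of the plane. The vector `γ'` is not null at `p` (`firstForm_self_pos`:
otherwise the nonnegative functions `E` and `G` would vanish to second order at `p`, so that
`lam² = E G - F² ≤ E G` would force `d lam = 0`). Hence `γ` can be parametrized by arc length, and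
following the orthogonal trajectories of the lines `y = const` from the axis gives coordinates
with `F = 0` that still have `γ` as the axis `v = 0` and `η` as `∂/∂v` there
(`exists_adapted_coordinates_of_normalized`). Now `E = 1` on the axis, and `E G` is the square of an
area density that vanishes on the axis, hence of the form `v² l²`. Rescaling `η` by a function of
the curve parameter makes `l² = 1` on the axis (`exists_adapted_coordinates`), whence
`G = v² l² / E = v² (1 + v β)` by Hadamard's lemma. Finally admissibility at the points of the axis,
where `∂/∂v` is null, reads `E_v = 2 F_u = 0` (`fderiv_coeff_of_isAdmissibleAt`), and two
applications of Hadamard's lemma give `E = 1 + v² α`.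

*Smooth dependence.* The orthogonal trajectories have to depend smoothly on their initial
values (`exists_smooth_local_flow`). After rescaling time to `[0, 1]`, the integral equation of the
flow is an equation in the Banach space of continuous curves whose left-hand side is smooth, because
superposition operators are (`contDiff_postcomp`), and the implicit function theorem solves it.
All of this is done for functions smooth on a neighbourhood of a point (`SmoothNear`), since
`ContDiffAt ℝ ∞` does not provide a neighbourhood on which all derivatives exist.

*Converse.* Near the origin the form `(1 + v² α) du² + v² (1 + v β) dv²` degenerates exactly on
`v = 0`, it agrees there to first order with `du²`, which makes every value of `Γ(X, Y, Z)` with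
null `Z` cancel (`isAdmissibleAt_normalForm`), and `v √((1 + v² α) (1 + v β))` is an area density in
the standard chart; multiplied by Jacobians it gives one in every chart (`gram_transition`).
-/

noncomputable section

namespace Kossowski

/-! ### Smooth superposition operators and parameter integrals -/

section Nemytskii

universe u

variable {X : Type*} [TopologicalSpace X] [CompactSpace X]
variable {E F : Type u} [NormedAddCommGroup E] [NormedSpace ℝ E] [NormedAddCommGroup F]
  [NormedSpace ℝ F]

variable (X E F) in
/-- Pointwise application of a continuous family of operators to a continuous function. -/
def pointwiseApply : C(X, E →L[ℝ] F) →L[ℝ] C(X, E) →L[ℝ] C(X, F) :=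
  LinearMap.mkContinuous₂
    (LinearMap.mk₂ ℝ (fun (A : C(X, E →L[ℝ] F)) (h : C(X, E)) =>
        (⟨fun x => A x (h x), by fun_prop⟩ : C(X, F)))
      (fun A B h => by ext; simp) (fun c A h => by ext; simp)
      (fun A h k => by ext; simp) (fun c A h => by ext; simp)) 1 (by
    intro A h
    rw [one_mul]
    refine (ContinuousMap.norm_le _ (by positivity)).2 fun x => ?_
    exact (A x).le_of_opNorm_le_of_le (A.norm_coe_le_norm x) (h.norm_coe_le_norm x))

@[simp] lemma pointwiseApply_apply (A : C(X, E →L[ℝ] F)) (h : C(X, E)) (x : X) :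
    pointwiseApply X E F A h x = A x (h x) := rfl

lemma hasFDerivAt_postcomp {f : E → F} (hf : ContDiff ℝ 1 f) (w : C(X, E)) :
    HasFDerivAt (fun w : C(X, E) => (⟨f, hf.continuous⟩ : C(E, F)).comp w)
      (pointwiseApply X E F
        ((⟨fderiv ℝ f, hf.continuous_fderiv one_ne_zero⟩ : C(E, E →L[ℝ] F)).comp w)) w := by
  set f' : C(E, E →L[ℝ] F) := ⟨fderiv ℝ f, hf.continuous_fderiv one_ne_zero⟩ with hf'
  rw [hasFDerivAt_iff_isLittleO, Asymptotics.isLittleO_iff]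
  intro ε hε
  have hc : Continuous fun v : C(X, E) => f'.comp v := f'.continuous_postcomp
  obtain ⟨δ, hδ, hball⟩ := (Metric.continuousAt_iff (α := C(X, E)) (β := C(X, E →L[ℝ] F))).1
    (hc.continuousAt (x := w)) ε hε
  filter_upwards [Metric.ball_mem_nhds w hδ] with v hv
  refine (ContinuousMap.norm_le _ (by positivity)).2 fun x => ?_
  -- the mean value inequality on the segment from `w x` to `v x`; each of its points is
  -- the value at `x` of a function that is `δ`-close to `w`
  have key := Convex.norm_image_sub_le_of_norm_hasFDerivWithin_le' (𝕜 := ℝ) (f := f)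
    (f' := fun y => fderiv ℝ f y) (φ := fderiv ℝ f (w x)) (C := ε) (s := segment ℝ (w x) (v x))
    (x := w x) (y := v x)
    (fun y _ => ((hf.differentiable one_ne_zero) y).hasFDerivAt.hasFDerivWithinAt) ?_
    (convex_segment _ _) (left_mem_segment _ _ _) (right_mem_segment _ _ _)
  · refine le_trans ?_ (key.trans (mul_le_mul_of_nonneg_left ?_ hε.le))
    · simp [hf']
    · exact ContinuousMap.norm_coe_le_norm (v - w) x
  · intro y hy
    obtain ⟨t, ht, rfl⟩ := segment_eq_image' ℝ (w x) (v x) ▸ hy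
    have h1 : dist (w + t • (v - w)) w < δ := by
      rw [dist_eq_norm, add_sub_cancel_left, norm_smul]
      rw [Metric.mem_ball, dist_eq_norm] at hv
      refine lt_of_le_of_lt (mul_le_of_le_one_left (norm_nonneg _) ?_) hv
      rw [Real.norm_eq_abs, abs_of_nonneg ht.1]
      exact ht.2
    have h2 := hball h1
    rw [← dist_eq_norm]
    exact (ContinuousMap.dist_apply_le_dist (f := f'.comp (w + t • (v - w)))
      (g := f'.comp w) x).trans h2.le

/-- The superposition operator `w ↦ f ∘ w` of a smooth function is smooth. Its derivative is again
given by a superposition operator, that of `fderiv ℝ f`, so that this is an induction on the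
order of differentiability. -/
theorem contDiff_postcomp {f : E → F} (hf : ContDiff ℝ ∞ f) :
    ContDiff ℝ ∞ (fun w : C(X, E) => (⟨f, hf.continuous⟩ : C(E, F)).comp w) := by
  rw [contDiff_infty]
  intro n
  induction n generalizing F with
  | zero => exact contDiff_zero.2 (ContinuousMap.continuous_postcomp _)
  | succ n ih =>
    have hf1 : ContDiff ℝ 1 f := hf.of_le (by exact_mod_cast le_top)
    have hf' : ContDiff ℝ ∞ (fderiv ℝ f) := hf.fderiv_right (by simp)
    push_cast
    rw [contDiff_succ_iff_hasFDerivAt]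
    · exact ⟨fun w => pointwiseApply X E F
          ((⟨fderiv ℝ f, hf'.continuous⟩ : C(E, E →L[ℝ] F)).comp w),
        (ih hf').continuousLinearMap_comp (pointwiseApply X E F),
        fun w => hasFDerivAt_postcomp hf1 w⟩

end Nemytskii

section Integral

universe u

variable {E F : Type u} [NormedAddCommGroup E] [NormedSpace ℝ E] [NormedAddCommGroup F]
  [NormedSpace ℝ F]

open MeasureTheory unitInterval

variable (F) in
/-- Integration over the unit interval, as a continuous linear map. -/
def integralI : C(I, F) →L[ℝ] F :=
  LinearMap.mkContinuous
    { toFun := fun w => ∫ r, w r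
      map_add' := fun v w => by
        simpa using integral_add (v.continuous.integrable_of_hasCompactSupport
          (HasCompactSupport.of_compactSpace _)) (w.continuous.integrable_of_hasCompactSupport
          (HasCompactSupport.of_compactSpace _))
      map_smul' := fun c w => by simpa using integral_smul c (fun r => w r) } 1 (fun w => by
    have := norm_integral_le_of_norm_le_const (μ := (volume : Measure I)) (f := fun r => w r)
      (C := ‖w‖) (Filter.Eventually.of_forall fun r => w.norm_coe_le_norm r)
    simpa using this)

lemma integralI_apply (w : C(I, F)) : integralI F w = ∫ r, w r := rfl

lemma integralI_eq (w : ℝ → F) (hw : Continuous w) :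
    integralI F ⟨fun r : I => w r, by fun_prop⟩ = ∫ r in (0 : ℝ)..1, w r := by
  rw [integralI_apply, intervalIntegral.integral_of_le zero_le_one,
    ← integral_Icc_eq_integral_Ioc]
  exact integral_subtype_comap (μ := volume) measurableSet_Icc w

/-- Smooth dependence of an integral on a parameter. -/
lemma contDiff_integralI {f : E × ℝ → F} (hf : ContDiff ℝ ∞ f) :
    ContDiff ℝ ∞ (fun z => ∫ r in (0 : ℝ)..1, f (z, r)) := by
  have h0 : ContDiff ℝ ∞ (fun z : E × ℝ => f (z.1, z.2)) := hf
  let ι : E →L[ℝ] C(I, E × ℝ) := LinearMap.mkContinuous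
    { toFun := fun z => ContinuousMap.const I (z, 0)
      map_add' := fun a b => by ext <;> simp
      map_smul' := fun a b => by ext <;> simp } 1 (fun z => by
      refine (ContinuousMap.norm_le _ (by positivity)).2 fun x => ?_
      simp)
  let c : C(I, E × ℝ) := ⟨fun r => (0, (r : ℝ)), by fun_prop⟩
  have h1 : ContDiff ℝ ∞ (fun z => ι z + c) := ι.contDiff.add contDiff_const
  have h2 := (integralI F).contDiff.comp ((contDiff_postcomp (X := I) hf).comp h1)
  convert h2 using 2 with z
  rw [← integralI_eq (fun r => f (z, r)) (by have := hf.continuous; fun_prop)]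
  simp only [Function.comp_apply]
  congr 1
  ext r
  simp [ι, c]

/-- Hadamard's lemma, with a parameter. -/
lemma exists_contDiff_eq_add_smul {f : E × ℝ → F} [CompleteSpace F] (hf : ContDiff ℝ ∞ f) :
    ∃ f₁ : E × ℝ → F, ContDiff ℝ ∞ f₁ ∧ ∀ z t, f (z, t) = f (z, 0) + t • f₁ (z, t) := by
  let g : (E × ℝ) × ℝ → F := fun p => fderiv ℝ f (p.1.1, p.2 * p.1.2) (0, 1)
  have hg : ContDiff ℝ ∞ g := by
    have h1 : ContDiff ℝ ∞ (fderiv ℝ f) := hf.fderiv_right (by simp)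
    exact (h1.comp (by fun_prop : ContDiff ℝ ∞ fun p : (E × ℝ) × ℝ =>
      (p.1.1, p.2 * p.1.2))).clm_apply contDiff_const
  refine ⟨_, contDiff_integralI hg, fun z t => ?_⟩
  have h2 : ∀ r ∈ Set.uIcc (0 : ℝ) 1, HasDerivAt (fun r => f (z, r * t)) (t • g ((z, t), r)) r := by
    intro r _
    have h3 : HasDerivAt (fun r : ℝ => (z, r * t)) ((0 : E), t) r := by
      have := (hasDerivAt_const r z).prodMk ((hasDerivAt_id r).mul_const t)
      simpa using this
    have h4 := ((hf.differentiable (by simp)) (z, r * t)).hasFDerivAt.comp_hasDerivAt r h3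
    have h5 : ((0 : E), t) = t • ((0 : E), (1 : ℝ)) := by simp
    rw [h5, map_smul] at h4
    exact h4
  have h6 := intervalIntegral.integral_eq_sub_of_hasDerivAt h2 (Continuous.intervalIntegrable
    (by have := hg.continuous; fun_prop) _ _)
  rw [intervalIntegral.integral_smul] at h6
  rw [h6]
  simp

end Integral

/-! ### Inverse functions and flows of class `C^∞` -/

section InverseFunction

variable {E F : Type*} [NormedAddCommGroup E] [NormedSpace ℝ E] [NormedAddCommGroup F]
  [NormedSpace ℝ F] [CompleteSpace E]

/-- The inverse function theorem for germs of `C^∞` maps: the domain of the local inverse can be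
chosen in such a way that both maps are smooth on the whole of it. (Differentiability of infinite
order at a single point would not be enough for this.) -/
lemma exists_openPartialHomeomorph {f : E → F} {a : E} (hf : ∀ᶠ x in 𝓝 a, ContDiffAt ℝ ∞ f x)
    {f' : E ≃L[ℝ] F} (hf' : HasFDerivAt f (f' : E →L[ℝ] F) a) {N : Set E} (hN : N ∈ 𝓝 a) :
    ∃ h : OpenPartialHomeomorph E F, (∀ x, h x = f x) ∧ a ∈ h.source ∧ h.source ⊆ N ∧
      ContDiffOn ℝ ∞ h h.source ∧ ContDiffOn ℝ ∞ h.symm h.target := by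
  have ha : ContDiffAt ℝ ∞ f a := hf.self_of_nhds
  let h₀ := ha.toOpenPartialHomeomorph f hf' (by simp)
  have hcont : ContinuousAt (fderiv ℝ f) a :=
    (ha.fderiv_right (m := 0) (by simp)).continuousAt
  have hinv : ∀ᶠ x in 𝓝 a, ∃ e : E ≃L[ℝ] F, (e : E →L[ℝ] F) = fderiv ℝ f x := by
    have h1 : Set.range ((↑) : (E ≃L[ℝ] F) → E →L[ℝ] F) ∈ 𝓝 (fderiv ℝ f a) := by
      rw [hf'.fderiv]
      exact ContinuousLinearEquiv.nhds f'
    exact hcont.eventually h1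
  obtain ⟨V, hVsub, hVo, hVa⟩ := eventually_nhds_iff.1 ((hf.and hinv).and
    (show ∀ᶠ x in 𝓝 a, x ∈ N from hN))
  refine ⟨h₀.restrOpen V hVo, fun x => rfl,
    ⟨ha.mem_toOpenPartialHomeomorph_source hf' (by simp), hVa⟩,
    fun x hx => (hVsub x hx.2).2, fun x hx => ((hVsub x hx.2).1.1).contDiffWithinAt, ?_⟩
  intro y hy
  have hs := (h₀.restrOpen V hVo).map_target hy
  obtain ⟨e, he⟩ := (hVsub _ hs.2).1.2
  refine (OpenPartialHomeomorph.contDiffAt_symm _ (f₀' := e) hy ?_ ?_).contDiffWithinAt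
  · rw [he]
    exact (((hVsub _ hs.2).1.1).differentiableAt (by simp)).hasFDerivAt
  · exact (hVsub _ hs.2).1.1

end InverseFunction

section Flow

open unitInterval

universe u

variable {E : Type u} [NormedAddCommGroup E]

/-- Multiplication by `τ` on the unit interval, as a continuous family of continuous maps. -/
def scaleFamily (w : C(I, E)) : C(I, C(I, E)) :=
  ContinuousMap.curry ⟨fun p : I × I => w (p.1 * p.2), by fun_prop⟩

@[simp] lemma scaleFamily_apply (w : C(I, E)) (τ r : I) : scaleFamily w τ r = w (τ * r) := rfl

variable [NormedSpace ℝ E]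

variable (E) in
/-- The primitive `τ ↦ ∫₀^τ w` of a continuous function on the unit interval, written as
`τ ∫₀¹ w (τ r) dr`. -/
def primitiveI : C(I, E) →L[ℝ] C(I, E) :=
  LinearMap.mkContinuous
    { toFun := fun w => ⟨fun τ => (τ : ℝ) • integralI E (scaleFamily w τ), by fun_prop⟩
      map_add' := fun v w => by
        ext τ
        have : scaleFamily (v + w) τ = scaleFamily v τ + scaleFamily w τ := by ext; simp
        simp [this]
      map_smul' := fun c w => by
        ext τ
        have : scaleFamily (c • w) τ = c • scaleFamily w τ := by ext; simp
        simp [this, smul_comm c] } ‖integralI E‖ (fun w => by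
    refine (ContinuousMap.norm_le _ (by positivity)).2 fun τ => ?_
    have h1 : ‖scaleFamily w τ‖ ≤ ‖w‖ :=
      (ContinuousMap.norm_le _ (by positivity)).2 fun r => w.norm_coe_le_norm _
    have h2 : ‖(τ : ℝ)‖ ≤ 1 := by
      rw [Real.norm_eq_abs, abs_of_nonneg τ.2.1]
      exact τ.2.2
    have h3 := (integralI E).le_of_opNorm_le_of_le le_rfl h1
    calc ‖(τ : ℝ) • integralI E (scaleFamily w τ)‖
        = ‖(τ : ℝ)‖ * ‖integralI E (scaleFamily w τ)‖ := norm_smul _ _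
      _ ≤ 1 * (‖integralI E‖ * ‖w‖) := mul_le_mul h2 h3 (norm_nonneg _) zero_le_one
      _ = _ := one_mul _)

lemma primitiveI_apply (w : C(I, E)) (τ : I) :
    primitiveI E w τ = (τ : ℝ) • integralI E (scaleFamily w τ) := rfl

variable (E) in
/-- The inclusion of the constant functions. -/
def constI : E →L[ℝ] C(I, E) :=
  LinearMap.mkContinuous
    { toFun := fun z => ContinuousMap.const I z
      map_add' := fun a b => by ext; simp
      map_smul' := fun a b => by ext; simp } 1 (fun z => by
      refine (ContinuousMap.norm_le _ (by positivity)).2 fun x => ?_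
      simp)

@[simp] lemma constI_apply (z : E) (τ : I) : constI E z τ = z := rfl

variable [CompleteSpace E]

/-- The smooth local flow of a smooth vector field. After the time rescaling `w τ = φ (z, t τ)` the
initial value problem reads `w = z + t ∫₀^τ f (w)`, an equation for `w` in the Banach space of
continuous functions on the unit interval which depends smoothly on all data and which, at
`t = 0`, is trivially solvable; the implicit function theorem applies. -/
theorem exists_smooth_local_flow {f : E → E} (hf : ContDiff ℝ ∞ f) (z₀ : E) :
    ∃ φ : E × ℝ → E, (∀ᶠ p in 𝓝 (z₀, (0 : ℝ)), ContDiffAt ℝ ∞ φ p) ∧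
      (∀ᶠ z in 𝓝 z₀, φ (z, 0) = z) ∧
      ∀ᶠ p in 𝓝 (z₀, (0 : ℝ)), HasDerivAt (fun t => φ (p.1, t)) (f (φ p)) p.2 := by
  let Nf : C(I, E) → C(I, E) := fun w => (⟨f, hf.continuous⟩ : C(E, E)).comp w
  have hNf : ContDiff ℝ ∞ Nf := contDiff_postcomp hf
  let H : (E × ℝ) × C(I, E) → C(I, E) :=
    fun q => q.2 - constI E q.1.1 - q.1.2 • primitiveI E (Nf q.2)
  let K : (E × ℝ) × C(I, E) → (E × ℝ) × C(I, E) := fun q => (q.1, H q)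
  let w₀ : C(I, E) := constI E z₀
  let u : (E × ℝ) × C(I, E) := ((z₀, 0), w₀)
  have hH : ContDiff ℝ ∞ H := by
    have h1 : ContDiff ℝ ∞ fun q : (E × ℝ) × C(I, E) => primitiveI E (Nf q.2) :=
      (primitiveI E).contDiff.comp (hNf.comp contDiff_snd)
    have h2 : ContDiff ℝ ∞ fun q : (E × ℝ) × C(I, E) => constI E q.1.1 :=
      (constI E).contDiff.comp (contDiff_fst.comp contDiff_fst)
    exact (contDiff_snd.sub h2).sub ((contDiff_snd.comp contDiff_fst).smul h1)
  have hK : ContDiff ℝ ∞ K := contDiff_fst.prodMk hH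
  -- at time `0` the derivative of `K` is unitriangular
  let L : E × ℝ →L[ℝ] C(I, E) := -((constI E).comp (ContinuousLinearMap.fst ℝ E ℝ)) -
    (ContinuousLinearMap.snd ℝ E ℝ).smulRight (primitiveI E (Nf w₀))
  let K' : ((E × ℝ) × C(I, E)) ≃L[ℝ] (E × ℝ) × C(I, E) :=
    ContinuousLinearEquiv.skewProd (.refl ℝ _) (.refl ℝ _) L
  have hK' : HasFDerivAt K (K' : _ →L[ℝ] _) u := by
    have h1 : HasFDerivAt (fun q : (E × ℝ) × C(I, E) => primitiveI E (Nf q.2))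
        (fderiv ℝ (fun q : (E × ℝ) × C(I, E) => primitiveI E (Nf q.2)) u) u :=
      ((((primitiveI E).contDiff (n := ∞)).comp (hNf.comp contDiff_snd)).differentiable
        (by simp) u).hasFDerivAt
    have h2 : HasFDerivAt (fun q : (E × ℝ) × C(I, E) => q.1.2)
        ((ContinuousLinearMap.snd ℝ E ℝ).comp (ContinuousLinearMap.fst ℝ (E × ℝ) C(I, E))) u :=
      ((ContinuousLinearMap.snd ℝ E ℝ).comp
        (ContinuousLinearMap.fst ℝ (E × ℝ) C(I, E))).hasFDerivAt
    have h3 : HasFDerivAt (fun q : (E × ℝ) × C(I, E) => constI E q.1.1)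
        ((constI E).comp ((ContinuousLinearMap.fst ℝ E ℝ).comp
          (ContinuousLinearMap.fst ℝ (E × ℝ) C(I, E)))) u :=
      ((constI E).comp ((ContinuousLinearMap.fst ℝ E ℝ).comp
        (ContinuousLinearMap.fst ℝ (E × ℝ) C(I, E)))).hasFDerivAt
    have h4 := hasFDerivAt_fst.prodMk ((hasFDerivAt_snd.sub h3).sub (h2.smul h1))
    refine h4.congr_fderiv ?_
    ext q τ <;> simp [K', L, u]
  obtain ⟨h, hhK, hu, -, -, hsymm⟩ := exists_openPartialHomeomorph (N := Set.univ)
    (Filter.Eventually.of_forall fun x => hK.contDiffAt) hK' Filter.univ_mem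
  have hKu : K u = ((z₀, 0), 0) := by simp [K, H, u, w₀]
  have hut : ((z₀, (0 : ℝ)), (0 : C(I, E))) ∈ h.target := by
    rw [← hKu, ← hhK]
    exact h.map_source hu
  have hus : h.symm ((z₀, (0 : ℝ)), (0 : C(I, E))) = u := by
    rw [← hKu, ← hhK]
    exact h.left_inv hu
  let W : E × ℝ → C(I, E) := fun p => (h.symm (p, 0)).2
  have hι : Continuous fun p : E × ℝ => (p, (0 : C(I, E))) := by fun_prop
  have htgt : ∀ᶠ p in 𝓝 (z₀, (0 : ℝ)), (p, (0 : C(I, E))) ∈ h.target :=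
    hι.continuousAt.eventually (h.open_target.mem_nhds hut)
  have hWsmooth : ∀ᶠ p in 𝓝 (z₀, (0 : ℝ)), ContDiffAt ℝ ∞ W p := by
    filter_upwards [htgt] with p hp
    have h1 := (hsymm _ hp).contDiffAt (h.open_target.mem_nhds hp)
    exact contDiffAt_snd.comp p
      (ContDiffAt.comp p (g := h.symm) (f := fun p : E × ℝ => (p, (0 : C(I, E)))) h1
        (by fun_prop))
  have hW0 : W (z₀, 0) = w₀ := by simp [W, hus, u]
  have hWeq : ∀ p, (p, (0 : C(I, E))) ∈ h.target → K (p, W p) = (p, 0) := by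
    intro p hp
    have h1 := h.right_inv hp
    rw [hhK] at h1
    have h2 : (h.symm (p, 0)).1 = p := congrArg Prod.fst h1
    have h3 : h.symm (p, 0) = (p, W p) := Prod.ext h2 rfl
    rwa [h3] at h1
  -- uniqueness near `u`
  have huniq : ∀ p w, (p, w) ∈ h.source → K (p, w) = (p, 0) → w = W p := by
    intro p w hpw hk
    have h1 := h.left_inv hpw
    rw [hhK, hk] at h1
    exact (congrArg Prod.snd h1).symm
  obtain ⟨ε, hε, hball⟩ := Metric.mem_nhds_iff.1 (h.open_source.mem_nhds hu)
  have hWclose : ∀ᶠ p in 𝓝 (z₀, (0 : ℝ)), dist (W p) w₀ < ε := by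
    have h1 := hWsmooth.self_of_nhds.continuousAt
    rw [ContinuousAt, hW0] at h1
    exact h1.eventually (Metric.ball_mem_nhds _ hε)
  obtain ⟨δ, hδ, hgood⟩ := Metric.eventually_nhds_iff_ball.1
    ((htgt.and hWclose).and (show ∀ᶠ p in 𝓝 (z₀, (0 : ℝ)), p ∈ Metric.ball (z₀, (0 : ℝ)) ε from
      Metric.ball_mem_nhds (z₀, (0 : ℝ)) hε))
  let φ : E × ℝ → E := fun p => W p 1
  have hscale : ∀ p ∈ Metric.ball (z₀, (0 : ℝ)) δ, ∀ τ : I,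
      W (p.1, τ * p.2) = scaleFamily (W p) τ := by
    intro p hp τ
    symm
    refine huniq _ _ (hball ?_) ?_
    · rw [Metric.mem_ball, Prod.dist_eq, max_lt_iff]
      constructor
      · have h1 := (hgood _ hp).2
        rw [Metric.mem_ball, Prod.dist_eq, max_lt_iff] at h1
        change dist (p.1, (τ : ℝ) * p.2) (z₀, (0 : ℝ)) < ε
        rw [Prod.dist_eq, max_lt_iff]
        refine ⟨h1.1, lt_of_le_of_lt ?_ h1.2⟩
        simp only [dist_zero_right, Real.norm_eq_abs, abs_mul]
        refine mul_le_of_le_one_left (abs_nonneg _) ?_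
        rw [abs_of_nonneg τ.2.1]
        exact τ.2.2
      · refine lt_of_le_of_lt ((ContinuousMap.dist_le dist_nonneg).2 fun r => ?_)
          (hgood _ hp).1.2
        exact ContinuousMap.dist_apply_le_dist (f := W p) (g := w₀) (τ * r)
    · have h1 : H (p, W p) = 0 := congrArg Prod.snd (hWeq p (hgood _ hp).1.1)
      refine Prod.ext rfl ?_
      ext r
      have h2 := DFunLike.congr_fun h1 (τ * r)
      simp only [H, primitiveI_apply, ContinuousMap.sub_apply, ContinuousMap.smul_apply,
        constI_apply, ContinuousMap.zero_apply] at h2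
      simp only [K, H, primitiveI_apply, ContinuousMap.sub_apply, ContinuousMap.smul_apply,
        constI_apply, ContinuousMap.zero_apply, scaleFamily_apply]
      have h3 : scaleFamily (Nf (scaleFamily (W p) τ)) r = scaleFamily (Nf (W p)) (τ * r) := by
        ext s
        simp [Nf, mul_assoc]
      rw [h3, ← h2, smul_smul, smul_smul]
      congr 2
      push_cast
      ring
  have hφball : ∀ p ∈ Metric.ball (z₀, (0 : ℝ)) δ,
      φ p = p.1 + ∫ s in (0 : ℝ)..p.2, f (φ (p.1, s)) := by
    intro p hp
    have h1 : H (p, W p) = 0 := congrArg Prod.snd (hWeq p (hgood _ hp).1.1)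
    have h2 := DFunLike.congr_fun h1 1
    simp only [H, primitiveI_apply, ContinuousMap.sub_apply, ContinuousMap.smul_apply,
      constI_apply, ContinuousMap.zero_apply, Set.Icc.coe_one, one_smul] at h2
    have h3 : integralI E (scaleFamily (Nf (W p)) 1) =
        ∫ r in (0 : ℝ)..1, f (φ (p.1, r * p.2)) := by
      have h4 : Continuous fun r : ℝ => f (W p (Set.projIcc 0 1 zero_le_one r)) := by
        have := hf.continuous
        have := (W p).continuous
        fun_prop
      have h5 := integralI_eq _ h4
      have h6 : (⟨fun r : I => f (W p (Set.projIcc 0 1 zero_le_one (r : ℝ))), by fun_prop⟩ :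
          C(I, E)) = scaleFamily (Nf (W p)) 1 := by
        ext r
        simp [Nf]
      rw [← h6, h5]
      refine intervalIntegral.integral_congr fun r hr => ?_
      rw [Set.uIcc_of_le zero_le_one] at hr
      simp only [φ]
      rw [hscale p hp ⟨r, hr⟩, Set.projIcc_of_mem _ hr]
      simp
    have h7 := intervalIntegral.smul_integral_comp_mul_right (a := 0) (b := 1)
      (fun s => f (φ (p.1, s))) p.2
    rw [h3, h7] at h2
    simp only [zero_mul, one_mul] at h2
    simp only [φ] at h2 ⊢
    rw [sub_sub, sub_eq_zero] at h2
    exact h2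
  have hφsmooth : ∀ᶠ p in 𝓝 (z₀, (0 : ℝ)), ContDiffAt ℝ ∞ φ p := by
    filter_upwards [hWsmooth] with p hp
    exact (ContinuousMap.evalCLM ℝ (1 : I)).contDiff.contDiffAt.comp p hp
  obtain ⟨δ', hδ', hsm⟩ := Metric.eventually_nhds_iff_ball.1
    (hφsmooth.and (show ∀ᶠ p in 𝓝 (z₀, (0 : ℝ)), p ∈ Metric.ball (z₀, (0 : ℝ)) δ from
      Metric.ball_mem_nhds (z₀, (0 : ℝ)) hδ))
  refine ⟨φ, hφsmooth, ?_, ?_⟩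
  · have h1 : ∀ᶠ z in 𝓝 z₀, (z, (0 : ℝ)) ∈ Metric.ball (z₀, (0 : ℝ)) δ := by
      have : Continuous fun z : E => (z, (0 : ℝ)) := by fun_prop
      exact this.continuousAt.eventually (Metric.ball_mem_nhds _ hδ)
    filter_upwards [h1] with z hz
    simpa using hφball _ hz
  · filter_upwards [Metric.ball_mem_nhds _ hδ'] with p hp
    rw [Metric.mem_ball, Prod.dist_eq, max_lt_iff] at hp
    have hmem : ∀ s ∈ Metric.ball (0 : ℝ) δ', (p.1, s) ∈ Metric.ball (z₀, (0 : ℝ)) δ' := by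
      intro s hs
      rw [Metric.mem_ball, Prod.dist_eq, max_lt_iff]
      exact ⟨hp.1, hs⟩
    have hcont : ContinuousOn (fun s => f (φ (p.1, s))) (Metric.ball (0 : ℝ) δ') := by
      intro s hs
      have h1 : ContinuousAt φ (p.1, s) := (hsm _ (hmem s hs)).1.continuousAt
      have h2 : ContinuousAt (fun s => φ (p.1, s)) s :=
        ContinuousAt.comp (f := fun s : ℝ => (p.1, s)) h1 (by fun_prop)
      exact (hf.continuous.continuousAt.comp h2).continuousWithinAt
    have hp2 : p.2 ∈ Metric.ball (0 : ℝ) δ' := hp.2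
    have hsub : Set.uIcc 0 p.2 ⊆ Metric.ball (0 : ℝ) δ' := by
      refine (convex_ball (0 : ℝ) δ').ordConnected.uIcc_subset ?_ hp2
      exact Metric.mem_ball_self hδ'
    have h1 : HasDerivAt (fun t => p.1 + ∫ s in (0 : ℝ)..t, f (φ (p.1, s))) (f (φ p)) p.2 := by
      have h2 := intervalIntegral.integral_hasDerivAt_right
        (hcont.mono hsub).intervalIntegrable
        (hcont.stronglyMeasurableAtFilter Metric.isOpen_ball _ hp2)
        (hcont.continuousAt (Metric.isOpen_ball.mem_nhds hp2))
      exact h2.const_add _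
    refine h1.congr_of_eventuallyEq ?_
    filter_upwards [Metric.isOpen_ball.mem_nhds hp2] with s hs
    exact hφball _ (hsm _ (hmem s hs)).2

end Flow

/-! ### Smooth germs -/

section SmoothNear

variable {E F G : Type*} [NormedAddCommGroup E] [NormedSpace ℝ E] [NormedAddCommGroup F]
  [NormedSpace ℝ F] [NormedAddCommGroup G] [NormedSpace ℝ G]

/-- `f` is of class `C^∞` on some neighbourhood of `x`, i.e. it represents a smooth germ at `x`.
(`ContDiffAt ℝ ∞ f x` is weaker: it only provides, for each finite order, a neighbourhood
depending on the order.) -/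
def SmoothNear (f : E → F) (x : E) : Prop := ∀ᶠ y in 𝓝 x, ContDiffAt ℝ ∞ f y

namespace SmoothNear

lemma contDiffAt {f : E → F} {x : E} (hf : SmoothNear f x) : ContDiffAt ℝ ∞ f x :=
  Filter.Eventually.self_of_nhds hf

lemma differentiableAt {f : E → F} {x : E} (hf : SmoothNear f x) : DifferentiableAt ℝ f x :=
  hf.contDiffAt.differentiableAt (by simp)

lemma continuousAt {f : E → F} {x : E} (hf : SmoothNear f x) : ContinuousAt f x :=
  hf.contDiffAt.continuousAt

lemma eventually_differentiableAt {f : E → F} {x : E} (hf : SmoothNear f x) :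
    ∀ᶠ y in 𝓝 x, DifferentiableAt ℝ f y := by
  filter_upwards [hf] with y hy using hy.differentiableAt (by simp)

lemma of_contDiff {f : E → F} (hf : ContDiff ℝ ∞ f) (x : E) : SmoothNear f x :=
  Filter.Eventually.of_forall fun _ => hf.contDiffAt

lemma of_contDiffOn {f : E → F} {s : Set E} {x : E} (hf : ContDiffOn ℝ ∞ f s) (hs : s ∈ 𝓝 x) :
    SmoothNear f x := by
  filter_upwards [eventually_mem_nhds_iff.2 hs] with y hy using hf.contDiffAt hy

lemma comp {g : F → G} {f : E → F} {x : E} (hg : SmoothNear g (f x)) (hf : SmoothNear f x) :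
    SmoothNear (fun y => g (f y)) x := by
  filter_upwards [hf, hf.continuousAt.eventually hg] with y hy hy' using hy'.comp y hy

lemma fderiv {f : E → F} {x : E} (hf : SmoothNear f x) : SmoothNear (fderiv ℝ f) x := by
  filter_upwards [hf] with y hy using hy.fderiv_right (by simp)

lemma deriv {f : ℝ → F} {x : ℝ} (hf : SmoothNear f x) : SmoothNear (deriv f) x := by
  filter_upwards [hf] with y hy
  exact (hy.fderiv_right (m := ∞) (by simp)).clm_apply contDiffAt_const

lemma add {f g : E → F} {x : E} (hf : SmoothNear f x) (hg : SmoothNear g x) :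
    SmoothNear (fun y => f y + g y) x := by
  filter_upwards [hf, hg] with y h1 h2 using h1.add h2

lemma mul {f g : E → ℝ} {x : E} (hf : SmoothNear f x) (hg : SmoothNear g x) :
    SmoothNear (fun y => f y * g y) x := by
  filter_upwards [hf, hg] with y h1 h2 using h1.mul h2

lemma smul {f : E → ℝ} {g : E → F} {x : E} (hf : SmoothNear f x) (hg : SmoothNear g x) :
    SmoothNear (fun y => f y • g y) x := by
  filter_upwards [hf, hg] with y h1 h2 using h1.smul h2

lemma neg {f : E → F} {x : E} (hf : SmoothNear f x) : SmoothNear (fun y => -f y) x := by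
  filter_upwards [hf] with y h1 using h1.neg

lemma sub {f g : E → F} {x : E} (hf : SmoothNear f x) (hg : SmoothNear g x) :
    SmoothNear (fun y => f y - g y) x := by
  filter_upwards [hf, hg] with y h1 h2 using h1.sub h2

lemma pow {f : E → ℝ} {x : E} (hf : SmoothNear f x) (n : ℕ) :
    SmoothNear (fun y => f y ^ n) x := by
  filter_upwards [hf] with y h1 using h1.pow n

lemma div {f g : E → ℝ} {x : E} (hf : SmoothNear f x) (hg : SmoothNear g x) (h0 : g x ≠ 0) :
    SmoothNear (fun y => f y / g y) x := by
  filter_upwards [hf, hg, hg.continuousAt.eventually_ne h0] with y h1 h2 h3 using h1.div h2 h3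

lemma sqrt {f : E → ℝ} {x : E} (hf : SmoothNear f x) (h0 : f x ≠ 0) :
    SmoothNear (fun y => √(f y)) x := by
  filter_upwards [hf, hf.continuousAt.eventually_ne h0] with y h1 h2 using h1.sqrt h2

lemma fst {f : E → F × G} {x : E} (hf : SmoothNear f x) : SmoothNear (fun y => (f y).1) x := by
  filter_upwards [hf] with y h1 using contDiffAt_fst.comp y h1

lemma snd {f : E → F × G} {x : E} (hf : SmoothNear f x) : SmoothNear (fun y => (f y).2) x := by
  filter_upwards [hf] with y h1 using contDiffAt_snd.comp y h1

lemma prodMk {f : E → F} {g : E → G} {x : E} (hf : SmoothNear f x) (hg : SmoothNear g x) :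
    SmoothNear (fun y => (f y, g y)) x := by
  filter_upwards [hf, hg] with y h1 h2 using h1.prodMk h2

lemma fderiv_apply {f : E → F} {x : E} (hf : SmoothNear f x) (v : E) :
    SmoothNear (fun y => _root_.fderiv ℝ f y v) x := by
  filter_upwards [hf.fderiv] with y h1 using h1.clm_apply contDiffAt_const

/-- Every smooth germ is represented by a globally smooth function. -/
lemma exists_contDiff [HasContDiffBump E] {f : E → F} {x : E} (hf : SmoothNear f x) :
    ∃ g : E → F, ContDiff ℝ ∞ g ∧ g =ᶠ[𝓝 x] f := by
  obtain ⟨ε, hε, h⟩ := Metric.eventually_nhds_iff_ball.1 hf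
  let χ : ContDiffBump x := ⟨ε / 4, ε / 2, by positivity, by linarith⟩
  refine ⟨fun y => χ y • f y, contDiff_iff_contDiffAt.2 fun y => ?_, ?_⟩
  · by_cases hy : y ∈ Metric.ball x ε
    · exact χ.contDiff.contDiffAt.smul (h y hy)
    · have h1 : ∀ᶠ z in 𝓝 y, z ∉ Metric.closedBall x (ε / 2) := by
        refine Metric.isClosed_closedBall.isOpen_compl.mem_nhds ?_
        simp only [Metric.mem_ball, not_lt] at hy
        simp only [Set.mem_compl_iff, Metric.mem_closedBall, not_le]
        linarith
      refine (contDiffAt_const (c := (0 : F))).congr_of_eventuallyEq ?_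
      filter_upwards [h1] with z hz
      rw [χ.zero_of_le_dist, zero_smul]
      simp only [Metric.mem_closedBall, not_le] at hz
      exact hz.le
  · filter_upwards [χ.eventuallyEq_one] with y hy
    simp [hy]

end SmoothNear

end SmoothNear

section Germs

/-- Hadamard's lemma in the variable `y`, for germs at the origin of the `(x, y)`-plane. -/
lemma exists_smoothNear_eq_add_mul {f : ℝ × ℝ → ℝ} (hf : SmoothNear f 0) :
    ∃ f₁ : ℝ × ℝ → ℝ, SmoothNear f₁ 0 ∧ (∀ᶠ z in 𝓝 (0 : ℝ × ℝ), f z = f (z.1, 0) + z.2 * f₁ z) ∧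
      ∀ᶠ x in 𝓝 (0 : ℝ), HasDerivAt (fun y => f (x, y)) (f₁ (x, 0)) 0 := by
  obtain ⟨g, hg, hgf⟩ := hf.exists_contDiff
  obtain ⟨f₁, hf₁, h⟩ := exists_contDiff_eq_add_smul hg
  have hι : Filter.Tendsto (fun z : ℝ × ℝ => (z.1, (0 : ℝ))) (𝓝 0) (𝓝 0) := by
    have : Continuous fun z : ℝ × ℝ => (z.1, (0 : ℝ)) := by fun_prop
    exact this.tendsto' _ _ rfl
  have hι' : Filter.Tendsto (fun x : ℝ => (x, (0 : ℝ))) (𝓝 0) (𝓝 (0 : ℝ × ℝ)) := by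
    have : Continuous fun x : ℝ => (x, (0 : ℝ)) := by fun_prop
    exact this.tendsto' _ _ rfl
  refine ⟨f₁, .of_contDiff hf₁ _, ?_, ?_⟩
  · filter_upwards [hgf, hι.eventually hgf] with z h1 h2
    rw [← h1, ← h2]
    exact h z.1 z.2
  · filter_upwards [hι'.eventually hgf.eventually_nhds] with x hx
    have h1 : (fun y => g (x, y)) =ᶠ[𝓝 0] fun y => f (x, y) := by
      have : Filter.Tendsto (fun y : ℝ => (x, y)) (𝓝 0) (𝓝 (x, 0)) :=
        (by fun_prop : Continuous fun y : ℝ => (x, y)).tendsto' _ _ rfl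
      exact this.eventually hx
    refine HasDerivAt.congr_of_eventuallyEq ?_ h1.symm
    have h2 : (fun y => g (x, y)) = fun y => g (x, 0) + y * f₁ (x, y) := funext fun y => h x y
    rw [h2]
    have h3 : DifferentiableAt ℝ (fun y => f₁ (x, y)) 0 := by
      have := hf₁.differentiable (by simp)
      fun_prop
    simpa using ((hasDerivAt_id (0 : ℝ)).mul h3.hasDerivAt).const_add (g (x, 0))

/-- The local solutions `y ↦ S (x, y)` of the scalar ordinary differential equation
`∂S/∂y = a (S, y)`, `S (x, 0) = x`, depend smoothly on `(x, y)`. -/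
lemma exists_smoothNear_scalar_flow {a : ℝ × ℝ → ℝ} (ha : SmoothNear a 0) :
    ∃ S : ℝ × ℝ → ℝ, SmoothNear S 0 ∧ (∀ᶠ x in 𝓝 (0 : ℝ), S (x, 0) = x) ∧
      ∀ᶠ z in 𝓝 (0 : ℝ × ℝ), HasDerivAt (fun y => S (z.1, y)) (a (S z, z.2)) z.2 := by
  obtain ⟨b, hb, hba⟩ := ha.exists_contDiff
  -- the autonomous system in the extended phase space
  obtain ⟨φ, h1, h2, h3⟩ := exists_smooth_local_flow (f := fun z : ℝ × ℝ => (b z, (1 : ℝ)))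
    (by fun_prop) 0
  let j : ℝ × ℝ → (ℝ × ℝ) × ℝ := fun z => ((z.1, 0), z.2)
  have hj : ContDiff ℝ ∞ j := by fun_prop
  have hj0 : j 0 = (0, 0) := rfl
  have hjt : Filter.Tendsto j (𝓝 0) (𝓝 (0, 0)) := hj.continuous.tendsto' _ _ hj0
  have hφj : SmoothNear (fun z => φ (j z)) 0 :=
    SmoothNear.comp (g := φ) (f := j) (x := 0) h1 (.of_contDiff hj _)
  have hx0 : Filter.Tendsto (fun x : ℝ => (x, (0 : ℝ))) (𝓝 0) (𝓝 (0 : ℝ × ℝ)) :=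
    (by fun_prop : Continuous fun x : ℝ => (x, (0 : ℝ))).tendsto' _ _ rfl
  have hinit : ∀ᶠ x in 𝓝 (0 : ℝ), φ ((x, 0), 0) = (x, 0) := hx0.eventually h2
  have hderiv : ∀ᶠ z in 𝓝 (0 : ℝ × ℝ),
      HasDerivAt (fun t => φ ((z.1, 0), t)) (b (φ (j z)), (1 : ℝ)) z.2 := hjt.eventually h3
  -- the time component of the solution is the time
  have htime : ∀ᶠ z in 𝓝 (0 : ℝ × ℝ), (φ (j z)).2 = z.2 := by
    have hinit' : ∀ᶠ z in 𝓝 (0 : ℝ × ℝ), φ ((z.1, 0), 0) = (z.1, 0) :=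
      continuous_fst.tendsto' (0 : ℝ × ℝ) 0 rfl |>.eventually hinit
    obtain ⟨ε, hε, hball⟩ := Metric.eventually_nhds_iff_ball.1 (hderiv.and hinit')
    filter_upwards [Metric.ball_mem_nhds _ hε] with z hz
    rw [← ball_prod_same] at hball hz
    have key : ∀ y ∈ Metric.ball (0 : ℝ) ε,
        HasDerivAt (fun t => (φ ((z.1, 0), t)).2 - t) 0 y := by
      intro y hy
      have h4 := (hball (z.1, y) ⟨hz.1, hy⟩).1
      have h5 := (hasFDerivAt_snd (𝕜 := ℝ) (E := ℝ) (F := ℝ)).comp_hasDerivAt y h4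
      refine (h5.sub (hasDerivAt_id y)).congr_deriv ?_
      simp
    have h6 := Metric.isOpen_ball.is_const_of_deriv_eq_zero
      (convex_ball (0 : ℝ) ε).isPreconnected
      (fun y hy => (key y hy).differentiableAt.differentiableWithinAt)
      (fun y hy => (key y hy).deriv) hz.2 (Metric.mem_ball_self hε)
    have h7 := (hball z hz).2
    simp only [h7, sub_zero] at h6
    simpa [j, sub_eq_zero] using h6
  have hφ0 : φ (j 0) = 0 := hinit.self_of_nhds
  refine ⟨fun z => (φ (j z)).1, hφj.fst, ?_, ?_⟩
  · filter_upwards [hinit] with x hx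
    simp [j, hx]
  · have hba' : ∀ᶠ z in 𝓝 (0 : ℝ × ℝ), b (φ (j z)) = a (φ (j z)) := by
      have h4 : Filter.Tendsto (fun z => φ (j z)) (𝓝 0) (𝓝 0) := by
        have := hφj.continuousAt.tendsto
        rwa [hφ0] at this
      exact h4.eventually hba
    filter_upwards [hderiv, htime, hba'] with z h4 h5 h6
    have h7 : φ (j z) = ((φ (j z)).1, z.2) := Prod.ext rfl h5
    have h8 := (hasFDerivAt_fst (𝕜 := ℝ) (E := ℝ) (F := ℝ)).comp_hasDerivAt z.2 h4
    rw [← h7, ← h6]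
    exact h8

/-- Reparametrization by arc length: `N` is the square of the speed. -/
lemma exists_arclength_parameter {N : ℝ → ℝ} (hN : SmoothNear N 0) (h0 : 0 < N 0) :
    ∃ σ : ℝ → ℝ, SmoothNear σ 0 ∧ σ 0 = 0 ∧ ∀ᶠ t in 𝓝 (0 : ℝ), N (σ t) * deriv σ t ^ 2 = 1 := by
  have hc : SmoothNear (fun t => 1 / √(N t)) 0 :=
    (SmoothNear.of_contDiff contDiff_const 0).div (hN.sqrt h0.ne') (by positivity)
  have ha : SmoothNear (fun z : ℝ × ℝ => 1 / √(N z.1)) 0 :=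
    SmoothNear.comp (f := Prod.fst) (x := (0 : ℝ × ℝ)) hc (.of_contDiff contDiff_fst _)
  obtain ⟨S, hS, hS0, hSd⟩ := exists_smoothNear_scalar_flow ha
  have hy0 : ContDiff ℝ ∞ fun y : ℝ => ((0 : ℝ), y) := by fun_prop
  have hσ0 : S (0, 0) = 0 := hS0.self_of_nhds
  have hσ : SmoothNear (fun y => S (0, y)) 0 :=
    SmoothNear.comp (g := S) (f := fun y : ℝ => ((0 : ℝ), y)) (x := 0) hS (.of_contDiff hy0 _)
  refine ⟨fun y => S (0, y), hσ, hσ0, ?_⟩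
  have h1 := (hy0.continuous.tendsto' 0 (0 : ℝ × ℝ) rfl).eventually hSd
  have h2 : ∀ᶠ y in 𝓝 (0 : ℝ), 0 < N (S (0, y)) := by
    have h3 : ContinuousAt (fun y => N (S (0, y))) 0 :=
      ContinuousAt.comp (g := N) (f := fun y => S (0, y)) (by
        rw [hσ0]
        exact hN.continuousAt) hσ.continuousAt
    refine h3.eventually (lt_mem_nhds ?_)
    change 0 < N (S (0, 0))
    rwa [hσ0]
  filter_upwards [h1, h2] with y h4 h5
  rw [h4.deriv, div_pow, Real.sq_sqrt h5.le]
  field_simp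

end Germs

/-! ### Semi-definite forms on the coordinate plane -/

section Plane

/-- The bilinear form `E du² + 2 F du dv + G dv²` in given coordinates. -/
def firstForm (E F G : ℝ × ℝ → ℝ) (y a b : ℝ × ℝ) : ℝ :=
  E y * (a.1 * b.1) + F y * (a.1 * b.2 + a.2 * b.1) + G y * (a.2 * b.2)

/-- The area form of the coordinate plane. -/
def cross (a b : ℝ × ℝ) : ℝ := a.1 * b.2 - a.2 * b.1

lemma gram_eq (E F G : ℝ × ℝ → ℝ) (y a b : ℝ × ℝ) :
    firstForm E F G y a a * firstForm E F G y b b - firstForm E F G y a b ^ 2 =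
      cross a b ^ 2 * (E y * G y - F y ^ 2) := by
  simp only [firstForm, cross]
  ring

variable {E F G lam : ℝ × ℝ → ℝ} {q : ℝ × ℝ}

lemma firstForm_add_smul (y a b c : ℝ × ℝ) (t : ℝ) :
    firstForm E F G y a (t • b + c) = t * firstForm E F G y a b + firstForm E F G y a c := by
  simp only [firstForm, Prod.fst_add, Prod.snd_add, Prod.smul_fst, Prod.smul_snd, smul_eq_mul]
  ring

lemma firstForm_smul_left (y a b : ℝ × ℝ) (t : ℝ) :
    firstForm E F G y (t • a) b = t * firstForm E F G y a b := by
  simp only [firstForm, Prod.smul_fst, Prod.smul_snd, smul_eq_mul]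
  ring

lemma firstForm_smul_right (y a b : ℝ × ℝ) (t : ℝ) :
    firstForm E F G y a (t • b) = t * firstForm E F G y a b := by
  simp only [firstForm, Prod.smul_fst, Prod.smul_snd, smul_eq_mul]
  ring

lemma firstForm_comm (y a b : ℝ × ℝ) :
    firstForm E F G y a b = firstForm E F G y b a := by
  simp only [firstForm]
  ring

lemma SmoothNear.firstForm {V : Type*} [NormedAddCommGroup V] [NormedSpace ℝ V]
    (hE : SmoothNear E q) (hF : SmoothNear F q) (hG : SmoothNear G q)
    {f a b : V → ℝ × ℝ} {x : V} (hf : SmoothNear f x) (hfx : f x = q)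
    (ha : SmoothNear a x) (hb : SmoothNear b x) :
    SmoothNear (fun z => firstForm E F G (f z) (a z) (b z)) x := by
  subst hfx
  exact (((hE.comp hf).mul (ha.fst.mul hb.fst)).add
    ((hF.comp hf).mul ((ha.fst.mul hb.snd).add (ha.snd.mul hb.fst)))).add
    ((hG.comp hf).mul (ha.snd.mul hb.snd))

lemma SmoothNear.cross {V : Type*} [NormedAddCommGroup V] [NormedSpace ℝ V]
    {a b : V → ℝ × ℝ} {x : V} (ha : SmoothNear a x) (hb : SmoothNear b x) :
    SmoothNear (fun z => cross (a z) (b z)) x :=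
  (ha.fst.mul hb.snd).sub (ha.snd.mul hb.fst)

/-- If a semi-definite form vanished identically at `q`, then `E` and `G` would vanish to second
order and `lam`, whose square is at most `E G`, would have a critical point. Hence a direction
transversal to a null direction has positive length as soon as `d lam ≠ 0`. -/
lemma firstForm_self_pos (hE : SmoothNear E q) (hG : SmoothNear G q)
    (hnonneg : ∀ᶠ y in 𝓝 q, ∀ a, 0 ≤ firstForm E F G y a a)
    (hdet : ∀ᶠ y in 𝓝 q, E y * G y - F y ^ 2 = lam y ^ 2)
    (hd : fderiv ℝ lam q ≠ 0) {a n : ℝ × ℝ} (hn : ∀ b, firstForm E F G q n b = 0)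
    (han : cross a n ≠ 0) : 0 < firstForm E F G q a a := by
  refine lt_of_le_of_ne (hnonneg.self_of_nhds a) fun h0 => hd ?_
  have hn1 := hn (1, 0)
  have hn2 := hn (0, 1)
  simp only [firstForm, mul_one, mul_zero, add_zero, zero_add] at hn1 hn2 h0
  have hE0 : E q = 0 := by
    have : cross a n ^ 2 * E q = 0 := by
      simp only [cross]
      linear_combination (-n.2 ^ 2) * h0 + (a.2 ^ 2 * n.1 - 2 * a.1 * a.2 * n.2) * hn1 -
        a.2 ^ 2 * n.2 * hn2
    exact (mul_eq_zero.1 this).resolve_left (pow_ne_zero 2 han)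
  have hG0 : G q = 0 := by
    have : cross a n ^ 2 * G q = 0 := by
      simp only [cross]
      linear_combination (-n.1 ^ 2) * h0 + (a.1 ^ 2 * n.2 - 2 * a.1 * a.2 * n.1) * hn2 -
        a.1 ^ 2 * n.1 * hn1
    exact (mul_eq_zero.1 this).resolve_left (pow_ne_zero 2 han)
  have hEnn : ∀ᶠ y in 𝓝 q, 0 ≤ E y := by
    filter_upwards [hnonneg] with y hy
    simpa [firstForm] using hy (1, 0)
  have hGnn : ∀ᶠ y in 𝓝 q, 0 ≤ G y := by
    filter_upwards [hnonneg] with y hy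
    simpa [firstForm] using hy (0, 1)
  have small : ∀ {f : ℝ × ℝ → ℝ}, SmoothNear f q → f q = 0 → (∀ᶠ y in 𝓝 q, 0 ≤ f y) →
      f =o[𝓝 q] fun y => y - q := by
    intro f hf hf0 hfnn
    have hmin : IsLocalMin f q := by
      filter_upwards [hfnn] with y hy
      rwa [hf0]
    have h1 := hf.differentiableAt.hasFDerivAt
    rw [hmin.fderiv_eq_zero, hasFDerivAt_iff_isLittleO] at h1
    simpa [hf0] using h1
  have h1 : (fun y => E y * G y) =o[𝓝 q] fun y => ‖y - q‖ * ‖y - q‖ :=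
    (small hE hE0 hEnn).norm_right.mul (small hG hG0 hGnn).norm_right
  have h2 : (fun y => lam y ^ 2) =o[𝓝 q] fun y => ‖y - q‖ ^ 2 := by
    simp_rw [pow_two (‖_‖)]
    refine Asymptotics.IsBigO.trans_isLittleO (.of_bound 1 ?_) h1
    filter_upwards [hdet, hEnn, hGnn] with y hy hy1 hy2
    rw [Real.norm_of_nonneg (sq_nonneg _), Real.norm_of_nonneg (mul_nonneg hy1 hy2), ← hy]
    nlinarith [sq_nonneg (F y)]
  have h3 : lam =o[𝓝 q] fun y => y - q := (h2.of_pow two_ne_zero).of_norm_right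
  have h4 : lam q = 0 := by
    have := hdet.self_of_nhds
    rw [hE0] at this
    nlinarith [sq_nonneg (F q), sq_nonneg (lam q)]
  have h5 : HasFDerivAt lam (0 : ℝ × ℝ →L[ℝ] ℝ) q := by
    rw [hasFDerivAt_iff_isLittleO]
    simpa [h4] using h3
  exact h5.fderiv

/-- Coordinates adapted to a curve of null points, when the curve is parametrized by arc length and
the null field is normalized. The coordinate lines `y = const` are the curves
`s ↦ γ s + y • η s` and the lines `x = const` are their orthogonal trajectories. -/
lemma exists_adapted_coordinates_of_normalized
    (hE : SmoothNear E q) (hF : SmoothNear F q) (hG : SmoothNear G q) (hlam : SmoothNear lam q)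
    (hdet : ∀ᶠ y in 𝓝 q, E y * G y - F y ^ 2 = lam y ^ 2)
    {γ η : ℝ → ℝ × ℝ} (hγ : SmoothNear γ 0) (hη : SmoothNear η 0) (hγ0 : γ 0 = q)
    (hnull : ∀ᶠ t in 𝓝 (0 : ℝ), ∀ b, firstForm E F G (γ t) (η t) b = 0)
    (hlamγ : ∀ᶠ t in 𝓝 (0 : ℝ), lam (γ t) = 0)
    (hunit : ∀ᶠ t in 𝓝 (0 : ℝ), firstForm E F G (γ t) (deriv γ t) (deriv γ t) = 1)
    (hnorm : ∀ᶠ t in 𝓝 (0 : ℝ), (fderiv ℝ lam (γ t) (η t) * cross (deriv γ t) (η t)) ^ 2 = 1) :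
    ∃ Θ : ℝ × ℝ → ℝ × ℝ, SmoothNear Θ 0 ∧ Θ 0 = q ∧
      cross (fderiv ℝ Θ 0 (1, 0)) (fderiv ℝ Θ 0 (0, 1)) ≠ 0 ∧
      (∀ᶠ x in 𝓝 (0 : ℝ), firstForm E F G (Θ (x, 0)) (fderiv ℝ Θ (x, 0) (1, 0))
        (fderiv ℝ Θ (x, 0) (1, 0)) = 1) ∧
      ∃ β : ℝ × ℝ → ℝ, SmoothNear β 0 ∧ ∀ᶠ z in 𝓝 (0 : ℝ × ℝ),
        firstForm E F G (Θ z) (fderiv ℝ Θ z (1, 0)) (fderiv ℝ Θ z (0, 1)) = 0 ∧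
        firstForm E F G (Θ z) (fderiv ℝ Θ z (0, 1)) (fderiv ℝ Θ z (0, 1)) =
          z.2 ^ 2 * (1 + z.2 * β z) := by
  have t1 : SmoothNear (fun z : ℝ × ℝ => z.1) 0 := .of_contDiff contDiff_fst 0
  have t2 : SmoothNear (fun z : ℝ × ℝ => z.2) 0 := .of_contDiff contDiff_snd 0
  have hx0 : Filter.Tendsto (fun x : ℝ => (x, (0 : ℝ))) (𝓝 0) (𝓝 (0 : ℝ × ℝ)) :=
    (by fun_prop : Continuous fun x : ℝ => (x, (0 : ℝ))).tendsto' _ _ rfl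
  have hfst : Filter.Tendsto (fun z : ℝ × ℝ => z.1) (𝓝 0) (𝓝 0) :=
    continuous_fst.tendsto' _ _ rfl
  -- the ruled parametrization and its partial derivatives `A` and `η`
  let Ψ : ℝ × ℝ → ℝ × ℝ := fun z => γ z.1 + z.2 • η z.1
  let A : ℝ × ℝ → ℝ × ℝ := fun z => deriv γ z.1 + z.2 • deriv η z.1
  have hη1 : SmoothNear (fun z : ℝ × ℝ => η z.1) 0 :=
    SmoothNear.comp (f := Prod.fst) (x := (0 : ℝ × ℝ)) hη t1
  have hΨ : SmoothNear Ψ 0 :=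
    (SmoothNear.comp (f := Prod.fst) (x := (0 : ℝ × ℝ)) hγ t1).add (t2.smul hη1)
  have hA : SmoothNear A 0 :=
    (SmoothNear.comp (f := Prod.fst) (x := (0 : ℝ × ℝ)) hγ.deriv t1).add
      (t2.smul (SmoothNear.comp (f := Prod.fst) (x := (0 : ℝ × ℝ)) hη.deriv t1))
  have hΨ0 : Ψ 0 = q := by simp [Ψ, hγ0]
  let a : ℝ × ℝ → ℝ := fun z =>
    -firstForm E F G (Ψ z) (A z) (η z.1) / firstForm E F G (Ψ z) (A z) (A z)
  have hAA : SmoothNear (fun z => firstForm E F G (Ψ z) (A z) (A z)) 0 :=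
    SmoothNear.firstForm hE hF hG hΨ hΨ0 hA hA
  have hAA0 : firstForm E F G (Ψ 0) (A 0) (A 0) = 1 := by
    have := hunit.self_of_nhds
    simpa [Ψ, A] using this
  have ha : SmoothNear a 0 :=
    (SmoothNear.firstForm hE hF hG hΨ hΨ0 hA hη1).neg.div hAA (by rw [hAA0]; exact one_ne_zero)
  obtain ⟨S, hS, hS0, hSd⟩ := exists_smoothNear_scalar_flow ha
  have hS00 : S 0 = 0 := hS0.self_of_nhds
  have hSy : SmoothNear (fun z => (S z, z.2)) 0 := hS.prodMk t2
  have hSy0 : (S 0, (0 : ℝ × ℝ).2) = 0 := by simp [hS00]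
  have hSyt : Filter.Tendsto (fun z : ℝ × ℝ => (S z, z.2)) (𝓝 0) (𝓝 0) := by
    have := hSy.continuousAt.tendsto
    rwa [hSy0] at this
  let Θ : ℝ × ℝ → ℝ × ℝ := fun z => Ψ (S z, z.2)
  have hΘ : SmoothNear Θ 0 := by
    refine SmoothNear.comp (g := Ψ) (f := fun z => (S z, z.2)) ?_ hSy
    rw [hSy0]
    exact hΨ
  have hΘ0 : Θ 0 = q := by
    rw [← hΨ0]
    exact congrArg Ψ hSy0
  -- the partial derivatives of the new parametrization
  have hΘx : ∀ᶠ z in 𝓝 (0 : ℝ × ℝ),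
      fderiv ℝ Θ z (1, 0) = fderiv ℝ S z (1, 0) • A (S z, z.2) ∧
      fderiv ℝ Θ z (0, 1) = a (S z, z.2) • A (S z, z.2) + η (S z) := by
    have hγS := (hfst.comp hSyt).eventually hγ.eventually_differentiableAt
    have hηS := (hfst.comp hSyt).eventually hη.eventually_differentiableAt
    filter_upwards [hS.eventually_differentiableAt, hSd, hγS, hηS] with z h1 h2 h3 h4
    simp only [Function.comp_apply] at h3 h4
    have h5 : HasFDerivAt Θ (((ContinuousLinearMap.toSpanSingleton ℝ (deriv γ (S z))).comp
        (fderiv ℝ S z)) + (z.2 • ((ContinuousLinearMap.toSpanSingleton ℝ (deriv η (S z))).comp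
        (fderiv ℝ S z)) + (ContinuousLinearMap.snd ℝ ℝ ℝ).smulRight (η (S z)))) z := by
      have g1 := h3.hasDerivAt.hasFDerivAt.comp z h1.hasFDerivAt
      have g2 := h4.hasDerivAt.hasFDerivAt.comp z h1.hasFDerivAt
      exact g1.add (hasFDerivAt_snd.smul g2)
    have h6 : fderiv ℝ S z (0, 1) = a (S z, z.2) := by
      have h7 : HasDerivAt (fun y : ℝ => (z.1, y)) ((0 : ℝ), (1 : ℝ)) z.2 :=
        (hasDerivAt_const z.2 z.1).prodMk (hasDerivAt_id z.2)
      exact (HasFDerivAt.comp_hasDerivAt (f := fun y : ℝ => (z.1, y)) z.2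
        h1.hasFDerivAt h7).unique h2
    rw [h5.fderiv]
    constructor
    · simp [A, smul_smul, mul_comm]
    · simp [A, h6, smul_smul, mul_comm, add_assoc]
  have hS1 : ∀ᶠ x in 𝓝 (0 : ℝ), S (x, 0) = x ∧ fderiv ℝ S (x, 0) (1, 0) = 1 := by
    filter_upwards [hS0.eventually_nhds, hx0.eventually hS.eventually_differentiableAt]
      with x h1 h2
    refine ⟨h1.self_of_nhds, ?_⟩
    have h3 : HasDerivAt (fun x : ℝ => (x, (0 : ℝ))) ((1 : ℝ), (0 : ℝ)) x :=
      (hasDerivAt_id x).prodMk (hasDerivAt_const x 0)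
    refine (HasFDerivAt.comp_hasDerivAt (f := fun x : ℝ => (x, (0 : ℝ))) x
        h2.hasFDerivAt h3).unique ?_
    exact (hasDerivAt_id x).congr_of_eventuallyEq h1
  have haxis : ∀ᶠ x in 𝓝 (0 : ℝ), Θ (x, 0) = γ x ∧ fderiv ℝ Θ (x, 0) (1, 0) = deriv γ x ∧
      fderiv ℝ Θ (x, 0) (0, 1) = η x := by
    filter_upwards [hS1, hx0.eventually hΘx, hnull] with x h1 h2 h3
    rw [h2.1, h2.2]
    simp only [Θ, h1.1, h1.2]
    have h4 : a (x, 0) = 0 := by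
      simp only [a, Ψ, zero_smul, add_zero]
      rw [firstForm_comm, h3]
      simp
    refine ⟨by simp [Ψ], by simp [A], by simp [h4]⟩
  have h00 := haxis.self_of_nhds
  have hX : SmoothNear (fun z => fderiv ℝ Θ z (1, 0)) 0 := hΘ.fderiv_apply _
  have hY : SmoothNear (fun z => fderiv ℝ Θ z (0, 1)) 0 := hΘ.fderiv_apply _
  -- the area density of the new coordinates
  let μ : ℝ × ℝ → ℝ := fun z =>
    cross (fderiv ℝ Θ z (1, 0)) (fderiv ℝ Θ z (0, 1)) * lam (Θ z)
  have hlamΘ : SmoothNear (fun z => lam (Θ z)) 0 :=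
    SmoothNear.comp (by rwa [hΘ0]) hΘ
  have hcr : SmoothNear (fun z => cross (fderiv ℝ Θ z (1, 0)) (fderiv ℝ Θ z (0, 1))) 0 :=
    hX.cross hY
  obtain ⟨l, hl, hμl, hμd⟩ := exists_smoothNear_eq_add_mul (hcr.mul hlamΘ)
  have hlaxis : ∀ᶠ x in 𝓝 (0 : ℝ), l (x, 0) ^ 2 = 1 := by
    have hγt : Filter.Tendsto γ (𝓝 0) (𝓝 q) := by
      have := hγ.continuousAt.tendsto
      rwa [hγ0] at this
    filter_upwards [haxis, hμd, hx0.eventually hcr.eventually_differentiableAt,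
      hx0.eventually hΘ.eventually_differentiableAt,
      hγt.eventually hlam.eventually_differentiableAt, hnorm, hlamγ]
      with x h1 h2 h3 h4 h5 h6 h7
    have h8 : HasDerivAt (fun y : ℝ => (x, y)) ((0 : ℝ), (1 : ℝ)) 0 :=
      (hasDerivAt_const 0 x).prodMk (hasDerivAt_id 0)
    have g1 := HasFDerivAt.comp_hasDerivAt (f := fun y : ℝ => (x, y)) 0 h3.hasFDerivAt h8
    have g2 := HasFDerivAt.comp_hasDerivAt (f := fun y : ℝ => (x, y)) 0 h4.hasFDerivAt h8
    rw [← h1.1] at h5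
    have g3 := HasFDerivAt.comp_hasDerivAt (f := fun y : ℝ => Θ (x, y)) 0 h5.hasFDerivAt g2
    have g4 := h2.unique (g1.mul g3)
    rw [g4]
    simp only [Function.comp_apply, h1.1, h1.2.1, h1.2.2, h7, mul_zero, zero_add]
    rw [mul_comm, h6]
  let e : ℝ × ℝ → ℝ := fun z =>
    firstForm E F G (Θ z) (fderiv ℝ Θ z (1, 0)) (fderiv ℝ Θ z (1, 0))
  have he : SmoothNear e 0 := SmoothNear.firstForm hE hF hG hΘ hΘ0 hX hX
  have heaxis : ∀ᶠ x in 𝓝 (0 : ℝ), e (x, 0) = 1 := by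
    filter_upwards [haxis, hunit] with x h1 h2
    simp only [e, h1.1, h1.2.1, h2]
  have he0 : e 0 = 1 := heaxis.self_of_nhds
  obtain ⟨β, hβ, hmβ, -⟩ := exists_smoothNear_eq_add_mul
    ((hl.pow 2).div he (by rw [he0]; exact one_ne_zero))
  refine ⟨Θ, hΘ, hΘ0, ?_, heaxis, β, hβ, ?_⟩
  · intro h
    have h1 := hnorm.self_of_nhds
    have h2 : cross (deriv γ 0) (η 0) = 0 := by
      rw [← h00.2.1, ← h00.2.2]
      exact h
    rw [h2] at h1
    simp at h1
  · have hΘt : Filter.Tendsto Θ (𝓝 0) (𝓝 q) := by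
      have := hΘ.continuousAt.tendsto
      rwa [hΘ0] at this
    filter_upwards [hΘx, hμl, hmβ, hΘt.eventually hdet, hfst.eventually haxis,
      hfst.eventually hlamγ, hfst.eventually hlaxis, hfst.eventually heaxis,
      he.continuousAt.eventually_ne (by rw [he0]; exact one_ne_zero : e 0 ≠ 0),
      hSyt.eventually (hAA.continuousAt.eventually_ne (by rw [hAA0]; exact one_ne_zero))]
      with z h1 h2 h3 h4 h5 h6 h7 h8 h9 h10
    have hortho : firstForm E F G (Θ z) (fderiv ℝ Θ z (1, 0)) (fderiv ℝ Θ z (0, 1)) = 0 := by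
      rw [h1.1, h1.2, firstForm_smul_left, firstForm_add_smul]
      have h11 : a (S z, z.2) * firstForm E F G (Θ z) (A (S z, z.2)) (A (S z, z.2)) =
          -firstForm E F G (Θ z) (A (S z, z.2)) (η (S z)) := div_mul_cancel₀ _ h10
      rw [h11]
      ring
    refine ⟨hortho, ?_⟩
    have hgram := gram_eq E F G (Θ z) (fderiv ℝ Θ z (1, 0)) (fderiv ℝ Θ z (0, 1))
    rw [hortho, h4] at hgram
    change e z * _ - _ = _ at hgram
    rw [h5.1, h6, mul_zero, zero_add] at h2
    rw [h7, h8] at h3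
    rw [← mul_right_inj' h9]
    have h12 : l z ^ 2 = e z * (1 + z.2 * β z) := by
      rw [div_one] at h3
      rw [← h3]
      field_simp
    calc _ = (cross (fderiv ℝ Θ z (1, 0)) (fderiv ℝ Θ z (0, 1)) * lam (Θ z)) ^ 2 := by
          linear_combination hgram
      _ = z.2 ^ 2 * l z ^ 2 := by rw [h2]; ring
      _ = _ := by rw [h12]; ring

/-- Coordinates adapted to a curve `γ` of null points with transversal null field `η`. -/
theorem exists_adapted_coordinates
    (hE : SmoothNear E q) (hF : SmoothNear F q) (hG : SmoothNear G q) (hlam : SmoothNear lam q)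
    (hnonneg : ∀ᶠ y in 𝓝 q, ∀ a, 0 ≤ firstForm E F G y a a)
    (hdet : ∀ᶠ y in 𝓝 q, E y * G y - F y ^ 2 = lam y ^ 2) (hd : fderiv ℝ lam q ≠ 0)
    {γ η : ℝ → ℝ × ℝ} (hγ : SmoothNear γ 0) (hη : SmoothNear η 0) (hγ0 : γ 0 = q)
    (hnull : ∀ᶠ t in 𝓝 (0 : ℝ), ∀ b, firstForm E F G (γ t) (η t) b = 0)
    (hli : cross (deriv γ 0) (η 0) ≠ 0) :
    ∃ Θ : ℝ × ℝ → ℝ × ℝ, SmoothNear Θ 0 ∧ Θ 0 = q ∧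
      cross (fderiv ℝ Θ 0 (1, 0)) (fderiv ℝ Θ 0 (0, 1)) ≠ 0 ∧
      (∀ᶠ x in 𝓝 (0 : ℝ), firstForm E F G (Θ (x, 0)) (fderiv ℝ Θ (x, 0) (1, 0))
        (fderiv ℝ Θ (x, 0) (1, 0)) = 1) ∧
      ∃ β : ℝ × ℝ → ℝ, SmoothNear β 0 ∧ ∀ᶠ z in 𝓝 (0 : ℝ × ℝ),
        firstForm E F G (Θ z) (fderiv ℝ Θ z (1, 0)) (fderiv ℝ Θ z (0, 1)) = 0 ∧
        firstForm E F G (Θ z) (fderiv ℝ Θ z (0, 1)) (fderiv ℝ Θ z (0, 1)) =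
          z.2 ^ 2 * (1 + z.2 * β z) := by
  have hγt : Filter.Tendsto γ (𝓝 0) (𝓝 q) := by
    have := hγ.continuousAt.tendsto
    rwa [hγ0] at this
  have hcr : SmoothNear (fun t => cross (deriv γ t) (η t)) 0 := hγ.deriv.cross hη
  -- a metric with a null vector has zero area density
  have hlamγ : ∀ᶠ t in 𝓝 (0 : ℝ), lam (γ t) = 0 := by
    filter_upwards [hγt.eventually hdet, hnull, hcr.continuousAt.eventually_ne hli]
      with t h1 h2 h3
    have h4 := gram_eq E F G (γ t) (deriv γ t) (η t)
    rw [firstForm_comm _ (deriv γ t) (η t), h2, h2, h1] at h4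
    have h5 : cross (deriv γ t) (η t) ^ 2 * lam (γ t) ^ 2 = 0 := by rw [← h4]; ring
    exact pow_eq_zero_iff two_ne_zero |>.1 ((mul_eq_zero.1 h5).resolve_left (pow_ne_zero 2 h3))
  have hpos : 0 < firstForm E F G (γ 0) (deriv γ 0) (deriv γ 0) := by
    rw [hγ0]
    exact firstForm_self_pos hE hG hnonneg hdet hd (hγ0 ▸ hnull.self_of_nhds) hli
  obtain ⟨σ, hσ, hσ0, hσN⟩ := exists_arclength_parameter
    (SmoothNear.firstForm hE hF hG hγ hγ0 hγ.deriv hγ.deriv) hpos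
  have hσt : Filter.Tendsto σ (𝓝 0) (𝓝 0) := by
    have := hσ.continuousAt.tendsto
    rwa [hσ0] at this
  have hγσ : SmoothNear (fun t => γ (σ t)) 0 := SmoothNear.comp (by rwa [hσ0]) hσ
  have hησ : SmoothNear (fun t => η (σ t)) 0 := SmoothNear.comp (by rwa [hσ0]) hσ
  have hγσ0 : γ (σ 0) = q := by rw [hσ0, hγ0]
  have hdγσ : ∀ᶠ t in 𝓝 (0 : ℝ), deriv (fun t => γ (σ t)) t = deriv σ t • deriv γ (σ t) := by
    filter_upwards [hσ.eventually_differentiableAt,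
      hσt.eventually hγ.eventually_differentiableAt] with t h1 h2
    exact (h2.hasDerivAt.scomp t h1.hasDerivAt).deriv
  have hσ1 : deriv σ 0 ≠ 0 := by
    intro h
    have := hσN.self_of_nhds
    simp [h] at this
  -- the factor which normalizes the null field
  let k : ℝ → ℝ := fun t =>
    fderiv ℝ lam (γ (σ t)) (η (σ t)) * cross (deriv (fun t => γ (σ t)) t) (η (σ t))
  have hk : SmoothNear k 0 := by
    refine SmoothNear.mul ?_ (hγσ.deriv.cross hησ)
    have h1 : SmoothNear (fun t => fderiv ℝ lam (γ (σ t))) 0 :=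
      SmoothNear.comp (by
        rw [hγσ0]
        exact hlam.fderiv) hγσ
    filter_upwards [h1, hησ] with t h2 h3 using h2.clm_apply h3
  have hk0 : k 0 ≠ 0 := by
    have h1 : fderiv ℝ lam q (deriv γ 0) = 0 := by
      have h2 : HasDerivAt (fun t => lam (γ t)) (fderiv ℝ lam q (deriv γ 0)) 0 :=
        HasFDerivAt.comp_hasDerivAt 0 (by
          rw [hγ0]
          exact hlam.differentiableAt.hasFDerivAt) hγ.differentiableAt.hasDerivAt
      exact h2.unique ((hasDerivAt_const 0 (0 : ℝ)).congr_of_eventuallyEq hlamγ)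
    simp only [k]
    rw [hdγσ.self_of_nhds, hγσ0, hσ0]
    refine mul_ne_zero (fun h2 => hd ?_) ?_
    · -- `deriv γ 0` and `η 0` span the plane
      refine ContinuousLinearMap.ext fun v => ?_
      have h3 : cross (deriv γ 0) (η 0) • v =
          cross v (η 0) • deriv γ 0 + cross (deriv γ 0) v • η 0 := by
        ext <;> simp [cross] <;> ring
      have h4 := congrArg (fderiv ℝ lam q) h3
      rw [map_add, map_smul, map_smul, map_smul, h1, h2] at h4
      simpa [hli] using h4
    · have h3 : cross (deriv σ 0 • deriv γ 0) (η 0) =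
          deriv σ 0 * cross (deriv γ 0) (η 0) := by
        simp only [cross, Prod.smul_fst, Prod.smul_snd, smul_eq_mul]
        ring
      rw [h3]
      exact mul_ne_zero hσ1 hli
  have hh : SmoothNear (fun t => 1 / √√(k t ^ 2)) 0 := by
    have h1 : 0 < √(k 0 ^ 2) := by positivity
    exact (SmoothNear.of_contDiff contDiff_const 0).div
      (((hk.pow 2).sqrt (pow_ne_zero 2 hk0)).sqrt h1.ne') (Real.sqrt_pos.2 h1).ne'
  refine exists_adapted_coordinates_of_normalized hE hF hG hlam hdet hγσ (hh.smul hησ) hγσ0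
    ?_ (hσt.eventually hlamγ) ?_ ?_
  · filter_upwards [hσt.eventually hnull] with t h1 b
    rw [firstForm_smul_left, h1, mul_zero]
  · filter_upwards [hdγσ, hσN] with t h1 h2
    rw [h1, firstForm_smul_left, firstForm_smul_right, ← h2]
    ring
  · filter_upwards [hk.continuousAt.eventually_ne hk0] with t h1
    have h2 : ∀ c : ℝ, cross (deriv (fun t => γ (σ t)) t) (c • η (σ t)) =
        c * cross (deriv (fun t => γ (σ t)) t) (η (σ t)) := by
      intro c
      simp only [cross, Prod.smul_fst, Prod.smul_snd, smul_eq_mul]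
      ring
    have h3 : 0 < √(k t ^ 2) := by positivity
    rw [h2, map_smul, smul_eq_mul]
    have h4 : (1 / √√(k t ^ 2)) ^ 2 = 1 / √(k t ^ 2) := by
      rw [div_pow, Real.sq_sqrt h3.le, one_pow]
    have h5 : √(k t ^ 2) ^ 2 = k t ^ 2 := Real.sq_sqrt (sq_nonneg _)
    calc _ = ((1 / √√(k t ^ 2)) ^ 2 * k t) ^ 2 := by simp only [k]; ring
      _ = 1 := by
        rw [h4, mul_pow, div_pow, h5]
        field_simp

end Plane

/-! ### The metric in charts -/

section Charts

variable {M : Type*} [TopologicalSpace M] [ChartedSpace Plane M]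

/-- The metric `g` read in the chart `e`, as a bilinear form on the plane. -/
def chartForm (g : BilinField M) (e : OpenPartialHomeomorph M Plane) (y a b : Plane) : ℝ :=
  g (e.symm y) (mfderiv (𝓡 2) (𝓡 2) e.symm y a) (mfderiv (𝓡 2) (𝓡 2) e.symm y b)

lemma coeff_eq_chartForm (g : BilinField M) (e : OpenPartialHomeomorph M Plane) (i j : Fin 2)
    (y : Plane) : coeff g e i j y =
      chartForm g e y (EuclideanSpace.single i 1) (EuclideanSpace.single j 1) := rfl

lemma plane_eq (a : Plane) :
    a = a 0 • EuclideanSpace.single 0 1 + a 1 • EuclideanSpace.single 1 1 := by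
  ext i
  fin_cases i <;> simp

lemma chartForm_add_smul_left (g : BilinField M) (e : OpenPartialHomeomorph M Plane)
    (y a a' b : Plane) (s t : ℝ) : chartForm g e y (s • a + t • a') b =
      s * chartForm g e y a b + t * chartForm g e y a' b := by
  let L : Plane →L[ℝ] Plane := mfderiv (𝓡 2) (𝓡 2) e.symm y
  let B : Plane →L[ℝ] Plane →L[ℝ] ℝ := g (e.symm y)
  change B (L (s • a + t • a')) (L b) = s * B (L a) (L b) + t * B (L a') (L b)
  simp

lemma chartForm_add_smul_right (g : BilinField M) (e : OpenPartialHomeomorph M Plane)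
    (y a b b' : Plane) (s t : ℝ) : chartForm g e y a (s • b + t • b') =
      s * chartForm g e y a b + t * chartForm g e y a b' := by
  let L : Plane →L[ℝ] Plane := mfderiv (𝓡 2) (𝓡 2) e.symm y
  let B : Plane →L[ℝ] Plane →L[ℝ] ℝ := g (e.symm y)
  change B (L a) (L (s • b + t • b')) = s * B (L a) (L b) + t * B (L a) (L b')
  simp

lemma chartForm_eq (g : BilinField M) (e : OpenPartialHomeomorph M Plane) (y a b : Plane) :
    chartForm g e y a b = coeff g e 0 0 y * (a 0 * b 0) + coeff g e 0 1 y * (a 0 * b 1) +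
      coeff g e 1 0 y * (a 1 * b 0) + coeff g e 1 1 y * (a 1 * b 1) := by
  conv_lhs => rw [plane_eq a, plane_eq b]
  rw [chartForm_add_smul_left, chartForm_add_smul_right, chartForm_add_smul_right]
  simp only [coeff_eq_chartForm]
  ring

lemma isOpen_transition {M : Type*} [TopologicalSpace M] (e e' : OpenPartialHomeomorph M Plane) :
    IsOpen (e.target ∩ e.symm ⁻¹' e'.source) :=
  e.symm.isOpen_inter_preimage e'.open_source

lemma mdifferentiable_of_mem_maximalAtlas {e : OpenPartialHomeomorph M Plane}
    (he : e ∈ IsManifold.maximalAtlas (𝓡 2) ∞ M) : e.MDifferentiable (𝓡 2) (𝓡 2) :=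
  ⟨(contMDiffOn_of_mem_maximalAtlas he).mdifferentiableOn (by simp),
    (contMDiffOn_symm_of_mem_maximalAtlas he).mdifferentiableOn (by simp)⟩

lemma contDiffOn_transition {e e' : OpenPartialHomeomorph M Plane}
    (he : e ∈ IsManifold.maximalAtlas (𝓡 2) ∞ M) (he' : e' ∈ IsManifold.maximalAtlas (𝓡 2) ∞ M) :
    ContDiffOn ℝ ∞ (fun y => e' (e.symm y)) (e.target ∩ e.symm ⁻¹' e'.source) := by
  rw [← contMDiffOn_iff_contDiffOn]
  exact (contMDiffOn_of_mem_maximalAtlas he').comp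
    ((contMDiffOn_symm_of_mem_maximalAtlas he).mono Set.inter_subset_left) fun y hy => hy.2

lemma mfderiv_symm_apply {e : OpenPartialHomeomorph M Plane}
    (he : e ∈ IsManifold.maximalAtlas (𝓡 2) ∞ M) {y : Plane} (hy : y ∈ e.target)
    (X : TangentSpace (𝓡 2) (e.symm y)) :
    mfderiv (𝓡 2) (𝓡 2) e.symm y (mfderiv (𝓡 2) (𝓡 2) e (e.symm y) X) = X := by
  have h1 := (mdifferentiable_of_mem_maximalAtlas he).symm_comp_deriv (e.map_target hy)
  rw [e.right_inv hy] at h1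
  exact DFunLike.congr_fun h1 X

lemma eq_chartForm {g : BilinField M} {e : OpenPartialHomeomorph M Plane}
    (he : e ∈ IsManifold.maximalAtlas (𝓡 2) ∞ M) {q : M} (hq : q ∈ e.source)
    (X Y : TangentSpace (𝓡 2) q) : g q X Y =
      chartForm g e (e q) (mfderiv (𝓡 2) (𝓡 2) e q X) (mfderiv (𝓡 2) (𝓡 2) e q Y) := by
  obtain ⟨y, hy, rfl⟩ : ∃ y ∈ e.target, e.symm y = q := ⟨e q, e.map_source hq, e.left_inv hq⟩
  rw [e.right_inv hy]
  exact (congrArg₂ (fun a b => g (e.symm y) a b) (mfderiv_symm_apply he hy X)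
    (mfderiv_symm_apply he hy Y)).symm

lemma chartForm_transition (g : BilinField M) {e e' : OpenPartialHomeomorph M Plane}
    (he : e ∈ IsManifold.maximalAtlas (𝓡 2) ∞ M) (he' : e' ∈ IsManifold.maximalAtlas (𝓡 2) ∞ M)
    {y : Plane} (hy : y ∈ e.target) (hy' : e.symm y ∈ e'.source) (a b : Plane) :
    chartForm g e y a b = chartForm g e' (e' (e.symm y))
      (fderiv ℝ (fun y => e' (e.symm y)) y a) (fderiv ℝ (fun y => e' (e.symm y)) y b) := by
  have h1 : fderiv ℝ (fun y => e' (e.symm y)) y =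
      (mfderiv (𝓡 2) (𝓡 2) e' (e.symm y)).comp (mfderiv (𝓡 2) (𝓡 2) e.symm y) := by
    rw [← mfderiv_eq_fderiv]
    exact mfderiv_comp y ((mdifferentiable_of_mem_maximalAtlas he').mdifferentiableAt hy')
      ((mdifferentiable_of_mem_maximalAtlas he).mdifferentiableAt_symm hy)
  rw [h1, chartForm, eq_chartForm he' hy']
  rfl

variable [IsManifold (𝓡 2) ∞ M]

lemma contMDiffOn_mfderiv_symm {e : OpenPartialHomeomorph M Plane}
    (he : e ∈ IsManifold.maximalAtlas (𝓡 2) ∞ M) (a : Plane) :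
    ContMDiffOn (𝓡 2) (𝓡 2).tangent ∞
      (fun y : Plane => (⟨e.symm y, mfderiv (𝓡 2) (𝓡 2) e.symm y a⟩ : TangentBundle (𝓡 2) M))
      e.target := by
  have h1 := (contMDiffOn_symm_of_mem_maximalAtlas he).contMDiffOn_tangentMapWithin
    (m := ∞) (by simp) e.open_target.uniqueMDiffOn
  have h2 : ContMDiffOn (𝓡 2) (𝓡 2).tangent ∞
      (fun y : Plane => (⟨y, a⟩ : TangentBundle (𝓡 2) Plane)) e.target :=
    contMDiffOn_vectorSpace_iff_contDiffOn.2 contDiffOn_const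
  refine (h1.comp h2 fun y hy => hy).congr fun y hy => ?_
  simp only [Function.comp_apply, tangentMapWithin]
  rw [mfderivWithin_of_isOpen e.open_target hy]

lemma contDiffOn_coeff {g : BilinField M} {W : Set M} (hg : IsSemiMetricOn g W)
    {e : OpenPartialHomeomorph M Plane} (he : e ∈ IsManifold.maximalAtlas (𝓡 2) ∞ M)
    (i j : Fin 2) : ContDiffOn ℝ ∞ (coeff g e i j) (e.target ∩ e.symm ⁻¹' W) := by
  have h0 : ContMDiffOn (𝓡 2) (𝓡 2) ∞ e.symm (e.target ∩ e.symm ⁻¹' W) :=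
    (contMDiffOn_symm_of_mem_maximalAtlas he).mono Set.inter_subset_left
  have h1 := hg.smooth.comp h0 fun y hy => hy.2
  have h2 := ContMDiffOn.clm_bundle_apply₂ (F₃ := ℝ) (E₃ := Bundle.Trivial M ℝ) (b := e.symm)
    (ψ := fun y => g (e.symm y)) h1
    ((contMDiffOn_mfderiv_symm he (EuclideanSpace.single i 1)).mono Set.inter_subset_left)
    ((contMDiffOn_mfderiv_symm he (EuclideanSpace.single j 1)).mono Set.inter_subset_left)
  rw [← contMDiffOn_iff_contDiffOn]
  intro y hy
  have h3 := h2 y hy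
  rw [Bundle.contMDiffWithinAt_totalSpace] at h3
  exact h3.2

/-- The Jacobian determinant of a map of the plane into itself. -/
def jacobian (f : Plane → Plane) (y : Plane) : ℝ :=
  fderiv ℝ f y (EuclideanSpace.single 0 1) 0 * fderiv ℝ f y (EuclideanSpace.single 1 1) 1 -
    fderiv ℝ f y (EuclideanSpace.single 0 1) 1 * fderiv ℝ f y (EuclideanSpace.single 1 1) 0

lemma coeff_symm {g : BilinField M} {W : Set M} (hg : IsSemiMetricOn g W)
    (e : OpenPartialHomeomorph M Plane) {y : Plane} (hy : e.symm y ∈ W) :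
    coeff g e 1 0 y = coeff g e 0 1 y :=
  hg.symm _ hy _ _

lemma gram_transition {g : BilinField M} {W : Set M} (hg : IsSemiMetricOn g W)
    {e e' : OpenPartialHomeomorph M Plane}
    (he : e ∈ IsManifold.maximalAtlas (𝓡 2) ∞ M) (he' : e' ∈ IsManifold.maximalAtlas (𝓡 2) ∞ M)
    {y : Plane} (hy : y ∈ e.target) (hy' : e.symm y ∈ e'.source) (hyW : e.symm y ∈ W) :
    coeff g e 0 0 y * coeff g e 1 1 y - coeff g e 0 1 y ^ 2 =
      jacobian (fun y => e' (e.symm y)) y ^ 2 *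
        (coeff g e' 0 0 (e' (e.symm y)) * coeff g e' 1 1 (e' (e.symm y)) -
          coeff g e' 0 1 (e' (e.symm y)) ^ 2) := by
  have h1 : coeff g e' 1 0 (e' (e.symm y)) = coeff g e' 0 1 (e' (e.symm y)) :=
    coeff_symm hg e' (by rwa [e'.left_inv hy'])
  simp only [coeff_eq_chartForm g e, chartForm_transition g he he' hy hy', chartForm_eq g e', h1,
    jacobian]
  ring

lemma contDiffOn_jacobian {f : Plane → Plane} {s : Set Plane} (hs : IsOpen s)
    (hf : ContDiffOn ℝ ∞ f s) : ContDiffOn ℝ ∞ (jacobian f) s := by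
  have h1 : ContDiffOn ℝ ∞ (fderiv ℝ f) s := hf.fderiv_of_isOpen hs (by simp)
  have h2 : ∀ (v : Plane) (i : Fin 2), ContDiffOn ℝ ∞ (fun y => fderiv ℝ f y v i) s :=
    fun v i => (contDiffOn_piLp _).1 (h1.clm_apply contDiffOn_const) i
  exact ((h2 _ _).mul (h2 _ _)).sub ((h2 _ _).mul (h2 _ _))

end Charts

/-! ### Coordinate fields and admissibility -/

section Admissible

variable {M : Type*} [TopologicalSpace M] [ChartedSpace Plane M]

/-- The coordinate vector fields of the chart `e`, as vector fields on the manifold (with the junk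
value `0` outside of the domain of `e`, where `e` has no invertible derivative). -/
def chartField (e : OpenPartialHomeomorph M Plane) (i : Fin 2) :
    ∀ x : M, TangentSpace (𝓡 2) x :=
  VectorField.mpullback (𝓡 2) (𝓡 2) e
    (fun _ : Plane => (EuclideanSpace.single i (1 : ℝ) : Plane))

lemma mlieBracket_eq_lieBracket (X Y : ∀ y : Plane, TangentSpace (𝓡 2) y) :
    VectorField.mlieBracket (𝓡 2) X Y = VectorField.lieBracket ℝ X Y := by
  rw [← VectorField.mlieBracketWithin_univ, VectorField.mlieBracketWithin_eq_lieBracketWithin]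
  exact VectorField.lieBracketWithin_univ

lemma isInvertible_mfderiv {e : OpenPartialHomeomorph M Plane}
    (he : e ∈ IsManifold.maximalAtlas (𝓡 2) ∞ M) {x : M} (hx : x ∈ e.source) :
    (mfderiv (𝓡 2) (𝓡 2) e x).IsInvertible :=
  ⟨(mdifferentiable_of_mem_maximalAtlas he).mfderiv hx, rfl⟩

lemma mfderiv_chartField {e : OpenPartialHomeomorph M Plane}
    (he : e ∈ IsManifold.maximalAtlas (𝓡 2) ∞ M) (i : Fin 2) {x : M} (hx : x ∈ e.source) :
    mfderiv (𝓡 2) (𝓡 2) e x (chartField e i x) = (EuclideanSpace.single i (1 : ℝ) : Plane) := by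
  obtain ⟨L, hL⟩ := isInvertible_mfderiv he hx
  have h1 : chartField e i x = L.symm (EuclideanSpace.single i (1 : ℝ) : Plane) := by
    change (mfderiv (𝓡 2) (𝓡 2) e x).inverse _ = _
    rw [← hL, ContinuousLinearMap.inverse_equiv]
    rfl
  rw [h1, ← hL]
  exact L.apply_symm_apply _

lemma chartField_apply {g : BilinField M} {e : OpenPartialHomeomorph M Plane}
    (he : e ∈ IsManifold.maximalAtlas (𝓡 2) ∞ M) (i j : Fin 2) {x : M} (hx : x ∈ e.source) :
    g x (chartField e i x) (chartField e j x) = coeff g e i j (e x) := by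
  rw [eq_chartForm he hx, mfderiv_chartField he i hx, mfderiv_chartField he j hx,
    coeff_eq_chartForm]

lemma dirDeriv_chartField {e : OpenPartialHomeomorph M Plane}
    (he : e ∈ IsManifold.maximalAtlas (𝓡 2) ∞ M) {x : M} (hx : x ∈ e.source)
    {X : ∀ x : M, TangentSpace (𝓡 2) x} {i : Fin 2} (hX : X x = chartField e i x)
    {φ : M → ℝ} {f : Plane → ℝ} (hf : DifferentiableAt ℝ f (e x))
    (hφ : φ =ᶠ[𝓝 x] fun x => f (e x)) :
    dirDeriv X φ x = fderiv ℝ f (e x) (EuclideanSpace.single i 1) := by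
  rw [dirDeriv, hX, hφ.mfderiv_eq]
  have h1 := mfderiv_comp x hf.mdifferentiableAt
    ((mdifferentiable_of_mem_maximalAtlas he).mdifferentiableAt hx)
  change mfderiv (𝓡 2) 𝓘(ℝ, ℝ) (f ∘ e) x _ = _
  rw [h1, mfderiv_eq_fderiv]
  exact congrArg (fderiv ℝ f (e x)) (mfderiv_chartField he i hx)

variable [IsManifold (𝓡 2) ∞ M]

lemma contMDiffOn_chartField {e : OpenPartialHomeomorph M Plane}
    (he : e ∈ IsManifold.maximalAtlas (𝓡 2) ∞ M) (i : Fin 2) :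
    ContMDiffOn (𝓡 2) (𝓡 2).tangent ∞
      (fun x : M => (⟨x, chartField e i x⟩ : TangentBundle (𝓡 2) M)) e.source := by
  intro x hx
  have h1 : ContMDiffAt (𝓡 2) (𝓡 2).tangent ∞ (fun y : Plane =>
      (⟨y, (EuclideanSpace.single i (1 : ℝ) : Plane)⟩ : TangentBundle (𝓡 2) Plane)) (e x) :=
    contMDiffAt_vectorSpace_iff_contDiffAt.2 contDiffAt_const
  exact (ContMDiffAt.mpullback_vectorField_preimage h1
    (contMDiffAt_of_mem_maximalAtlas he hx) (isInvertible_mfderiv he hx)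
    (by simp)).contMDiffWithinAt

lemma mlieBracket_chartField {e : OpenPartialHomeomorph M Plane}
    (he : e ∈ IsManifold.maximalAtlas (𝓡 2) ∞ M) (i j : Fin 2) {x : M} (hx : x ∈ e.source) :
    VectorField.mlieBracket (𝓡 2) (chartField e i) (chartField e j) x = 0 := by
  have h1 : ∀ k : Fin 2, ContMDiffAt (𝓡 2) (𝓡 2).tangent 1 (fun y : Plane =>
      (⟨y, (EuclideanSpace.single k (1 : ℝ) : Plane)⟩ : TangentBundle (𝓡 2) Plane)) (e x) :=
    fun k => contMDiffAt_vectorSpace_iff_contDiffAt.2 contDiffAt_const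
  have h3 : minSmoothness ℝ 2 ≤ ∞ := by
    rw [minSmoothness_of_isRCLikeNormedField]
    exact WithTop.coe_le_coe.2 le_top
  have : IsManifold (𝓡 2) (minSmoothness ℝ 2) M := IsManifold.of_le h3
  have h2 := VectorField.mpullback_mlieBracket (n := ∞)
    ((h1 i).mdifferentiableAt one_ne_zero) ((h1 j).mdifferentiableAt one_ne_zero)
    (contMDiffAt_of_mem_maximalAtlas he hx) h3
  refine h2.symm.trans ?_
  have h4 : VectorField.mlieBracket (𝓡 2)
      (fun _ : Plane => (EuclideanSpace.single i (1 : ℝ) : Plane))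
      (fun _ : Plane => (EuclideanSpace.single j (1 : ℝ) : Plane)) = 0 := by
    refine (mlieBracket_eq_lieBracket _ _).trans ?_
    funext y
    simp only [VectorField.lieBracket, fderiv_fun_const, Pi.zero_apply, _root_.zero_apply, sub_zero]
    rfl
  rw [h4, VectorField.mpullback_zero]
  rfl

/-- In a chart for which `∂/∂v` is null at `p`, admissibility at `p` says that `E_v = 2 F_u`. -/
lemma fderiv_coeff_of_isAdmissibleAt [T2Space M] {g : BilinField M} {W : Set M} (hW : IsOpen W)
    (hg : IsSemiMetricOn g W) {e : OpenPartialHomeomorph M Plane}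
    (he : e ∈ IsManifold.maximalAtlas (𝓡 2) ∞ M) {p : M} (hpe : p ∈ e.source) (hpW : p ∈ W)
    (hadm : IsAdmissibleAt g W p)
    (hnull : ∀ b, chartForm g e (e p) (EuclideanSpace.single 1 1) b = 0) :
    fderiv ℝ (coeff g e 0 0) (e p) (EuclideanSpace.single 1 1) =
      2 * fderiv ℝ (coeff g e 0 1) (e p) (EuclideanSpace.single 0 1) := by
  -- extend the coordinate fields from a neighbourhood of `p` to the whole manifold
  obtain ⟨χ, -, hχ⟩ := (SmoothBumpFunction.nhds_basis_tsupport (I := 𝓡 2) p).mem_iff.1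
    (e.open_source.mem_nhds hpe)
  let X : Fin 2 → ∀ x : M, TangentSpace (𝓡 2) x := fun i => (χ : M → ℝ) • chartField e i
  have hX : ∀ i, IsVectorFieldOn (X i) W := fun i =>
    (ContMDiffOn.smul_section_of_tsupport χ.contMDiff.contMDiffOn e.open_source hχ
      (contMDiffOn_chartField he i)).contMDiffOn
  have hXe : ∀ i, X i =ᶠ[𝓝 p] chartField e i := by
    intro i
    filter_upwards [χ.eventuallyEq_one] with x hx
    change χ x • chartField e i x = _
    rw [hx]
    exact one_smul ℝ _
  have hXp : ∀ i, X i p = chartField e i p := fun i => (hXe i).self_of_nhds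
  have hdiff : ∀ i j, DifferentiableAt ℝ (coeff g e i j) (e p) := fun i j =>
    ((contDiffOn_coeff hg he i j).contDiffAt
      ((e.symm.isOpen_inter_preimage hW).mem_nhds ⟨e.map_source hpe, by
        simpa [e.left_inv hpe] using hpW⟩)).differentiableAt (by simp)
  have hcoeff : ∀ i j, (fun x => g x (X i x) (X j x)) =ᶠ[𝓝 p] fun x => coeff g e i j (e x) := by
    intro i j
    filter_upwards [hXe i, hXe j, e.open_source.mem_nhds hpe] with x h1 h2 h3
    rw [h1, h2, chartField_apply he i j h3]
  have hbr : ∀ i j, VectorField.mlieBracket (𝓡 2) (X i) (X j) p = 0 := fun i j => by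
    rw [Filter.EventuallyEq.mlieBracket_vectorField_eq (hXe i) (hXe j),
      mlieBracket_chartField he i j hpe]
  have hnullp : X 1 p ∈ nullSpace g p := by
    intro Y
    rw [eq_chartForm he hpe, hXp, mfderiv_chartField he 1 hpe]
    exact hnull _
  have key := hadm (X 0) (X 0) (X 1) (hX 0) (hX 0) (hX 1) hnullp
  rw [pseudoConnection, dirDeriv_chartField he hpe (hXp 0) (hdiff 0 1) (hcoeff 0 1),
    dirDeriv_chartField he hpe (hXp 1) (hdiff 0 0) (hcoeff 0 0), hbr, hbr] at key
  simp only [map_zero, _root_.zero_apply] at key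
  linarith

end Admissible

/-! ### The area density -/

section Density

variable {M : Type*} [TopologicalSpace M] [ChartedSpace Plane M]

lemma jacobian_transition_ne_zero {e e' : OpenPartialHomeomorph M Plane}
    (he : e ∈ IsManifold.maximalAtlas (𝓡 2) ∞ M) (he' : e' ∈ IsManifold.maximalAtlas (𝓡 2) ∞ M)
    {y : Plane} (hy : y ∈ e.target) (hy' : e.symm y ∈ e'.source) :
    jacobian (fun y => e' (e.symm y)) y ≠ 0 := by
  have hinj : Function.Injective (fderiv ℝ (fun y => e' (e.symm y)) y) := by
    have h1 : fderiv ℝ (fun y => e' (e.symm y)) y =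
        (mfderiv (𝓡 2) (𝓡 2) e' (e.symm y)).comp (mfderiv (𝓡 2) (𝓡 2) e.symm y) := by
      rw [← mfderiv_eq_fderiv]
      exact mfderiv_comp y ((mdifferentiable_of_mem_maximalAtlas he').mdifferentiableAt hy')
        ((mdifferentiable_of_mem_maximalAtlas he).mdifferentiableAt_symm hy)
    rw [h1]
    exact ((mdifferentiable_of_mem_maximalAtlas he').mfderiv_injective hy').comp
      ((mdifferentiable_of_mem_maximalAtlas he).symm.mfderiv_injective hy)
  set L := fderiv ℝ (fun y => e' (e.symm y)) y with hL
  intro h0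
  rw [jacobian, ← hL] at h0
  have hker : ∀ s t : ℝ,
      s * L (EuclideanSpace.single 0 1) 0 + t * L (EuclideanSpace.single 1 1) 0 = 0 →
      s * L (EuclideanSpace.single 0 1) 1 + t * L (EuclideanSpace.single 1 1) 1 = 0 →
      s = 0 ∧ t = 0 := by
    intro s t h1 h2
    have h3 : L (s • EuclideanSpace.single 0 1 + t • EuclideanSpace.single 1 1) = L 0 := by
      rw [map_add, map_smul, map_smul, map_zero]
      ext i
      fin_cases i
      · simpa using h1
      · simpa using h2
    have h4 := hinj h3
    have h5 := congrFun (congrArg (fun v : Plane => (v : Fin 2 → ℝ)) h4)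
    exact ⟨by simpa using h5 0, by simpa using h5 1⟩
  obtain ⟨h1, h2⟩ := hker (L (EuclideanSpace.single 1 1) 1) (-L (EuclideanSpace.single 0 1) 1)
    (by linear_combination h0) (by ring)
  obtain ⟨h3, h4⟩ := hker (L (EuclideanSpace.single 1 1) 0) (-L (EuclideanSpace.single 0 1) 0)
    (by ring) (by linear_combination -h0)
  exact one_ne_zero (hker 1 0 (by linear_combination -h4) (by linear_combination -h2)).1

variable [IsManifold (𝓡 2) ∞ M]

lemma gram_eq_zero_of_isSingular {g : BilinField M} {W : Set M} (hg : IsSemiMetricOn g W)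
    {e : OpenPartialHomeomorph M Plane} (he : e ∈ IsManifold.maximalAtlas (𝓡 2) ∞ M)
    {p : M} (hpe : p ∈ e.source) (hpW : p ∈ W) (hp : IsSingular g p) :
    coeff g e 0 0 (e p) * coeff g e 1 1 (e p) - coeff g e 0 1 (e p) ^ 2 = 0 := by
  rw [IsSingular] at hp
  push Not at hp
  obtain ⟨X, hX, hXX⟩ := hp
  have hXX0 : g p X X = 0 := le_antisymm hXX (hg.nonneg p hpW X)
  rw [eq_chartForm he hpe] at hXX0
  obtain ⟨a, ha⟩ : ∃ a : Plane, a = mfderiv (𝓡 2) (𝓡 2) e p X := ⟨_, rfl⟩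
  replace hXX0 : chartForm g e (e p) a a = 0 := by
    rw [ha]
    exact hXX0
  have ha0 : a ≠ 0 := by
    intro h
    apply hX
    apply (mdifferentiable_of_mem_maximalAtlas he).mfderiv_injective hpe
    rw [map_zero, ← ha]
    exact h
  have hepW : e.symm (e p) ∈ W := by rwa [e.left_inv hpe]
  have hsymm := coeff_symm hg e hepW
  -- a vector of length zero of a semi-definite form is null
  have hnull : ∀ b, chartForm g e (e p) a b = 0 := by
    intro b
    by_contra h
    have h1 : ∀ t : ℝ, 0 ≤ chartForm g e (e p) b b + t * (2 * chartForm g e (e p) a b) := by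
      intro t
      have h2 : chartForm g e (e p) (t • a + (1 : ℝ) • b) (t • a + (1 : ℝ) • b) =
          chartForm g e (e p) b b + t * (2 * chartForm g e (e p) a b) := by
        have h3 : chartForm g e (e p) b a = chartForm g e (e p) a b := hg.symm _ hepW _ _
        rw [chartForm_add_smul_left, chartForm_add_smul_right, chartForm_add_smul_right, h3, hXX0]
        ring
      rw [← h2]
      exact hg.nonneg _ hepW _
    have h4 := h1 (-(chartForm g e (e p) b b + 1) / (2 * chartForm g e (e p) a b))
    rw [div_mul_cancel₀ _ (mul_ne_zero two_ne_zero h)] at h4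
    linarith
  have h0 := hnull (EuclideanSpace.single 0 1)
  have h1 := hnull (EuclideanSpace.single 1 1)
  rw [chartForm_eq, hsymm] at h0 h1
  simp at h0 h1
  by_contra hdet
  apply ha0
  have h2 : a 0 = 0 := by
    refine (mul_eq_zero.1 (?_ : (coeff g e 0 0 (e p) * coeff g e 1 1 (e p) -
      coeff g e 0 1 (e p) ^ 2) * a 0 = 0)).resolve_left hdet
    linear_combination coeff g e 1 1 (e p) * h0 - coeff g e 0 1 (e p) * h1
  have h3 : a 1 = 0 := by
    refine (mul_eq_zero.1 (?_ : (coeff g e 0 0 (e p) * coeff g e 1 1 (e p) -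
      coeff g e 0 1 (e p) ^ 2) * a 1 = 0)).resolve_left hdet
    linear_combination coeff g e 0 0 (e p) * h1 - coeff g e 0 1 (e p) * h0
  rw [plane_eq a, h2, h3]
  simp

/-- Non-degeneracy of a singular point can be read off in every chart: the area density of one
chart, multiplied by the Jacobian of the transition map, is an area density of the other. -/
lemma exists_areaDensity {g : BilinField M} {W : Set M} (hW : IsOpen W) (hg : IsSemiMetricOn g W)
    {e : OpenPartialHomeomorph M Plane} (he : e ∈ IsManifold.maximalAtlas (𝓡 2) ∞ M)
    {p : M} (hpe : p ∈ e.source) (hpW : p ∈ W) (hp : IsSingular g p)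
    (hnd : IsNondegenerateAt g p) :
    ∃ lam : Plane → ℝ, SmoothNear lam (e p) ∧ (∀ᶠ y in 𝓝 (e p),
      coeff g e 0 0 y * coeff g e 1 1 y - coeff g e 0 1 y ^ 2 = lam y ^ 2) ∧
      fderiv ℝ lam (e p) ≠ 0 := by
  obtain ⟨e', he', hpe', V, hVo, hpV, -, lam', ⟨hlam', hdet'⟩, hd'⟩ := hnd
  let ψ : Plane → Plane := fun y => e' (e.symm y)
  have hψp : ψ (e p) = e' p := by simp only [ψ, e.left_inv hpe]
  have hmem : e p ∈ e.target ∩ e.symm ⁻¹' e'.source := ⟨e.map_source hpe, by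
    simpa [e.left_inv hpe] using hpe'⟩
  have hψ : SmoothNear ψ (e p) := SmoothNear.of_contDiffOn (contDiffOn_transition he he')
    ((isOpen_transition e e').mem_nhds hmem)
  have hJ : SmoothNear (jacobian ψ) (e p) := SmoothNear.of_contDiffOn
    (contDiffOn_jacobian (isOpen_transition e e') (contDiffOn_transition he he'))
    ((isOpen_transition e e').mem_nhds hmem)
  have hlam0 : SmoothNear lam' (ψ (e p)) := by
    rw [hψp]
    exact .of_contDiffOn hlam' (hVo.mem_nhds hpV)
  refine ⟨fun y => jacobian ψ y * lam' (ψ y), hJ.mul (hlam0.comp hψ), ?_, ?_⟩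
  · have h1 : ∀ᶠ y in 𝓝 (e p), ψ y ∈ V := hψ.continuousAt.eventually (by
      rw [hψp]
      exact hVo.mem_nhds hpV)
    filter_upwards [h1, (isOpen_transition e e').mem_nhds hmem,
      (e.symm.isOpen_inter_preimage hW).mem_nhds (show e p ∈ e.symm.source ∩ e.symm ⁻¹' W from
        ⟨e.map_source hpe, by simpa [e.left_inv hpe] using hpW⟩)] with y h2 h3 h4
    rw [gram_transition hg he he' h3.1 h3.2 h4.2, hdet' _ h2, mul_pow]
  · have hzero : lam' (e' p) = 0 := by
      have := hdet' _ hpV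
      rw [gram_eq_zero_of_isSingular hg he' hpe' hpW hp] at this
      exact pow_eq_zero_iff two_ne_zero |>.1 this.symm
    have h1 := hJ.differentiableAt.hasFDerivAt.mul
      (hlam0.differentiableAt.hasFDerivAt.comp (e p) hψ.differentiableAt.hasFDerivAt)
    change HasFDerivAt (fun y => jacobian ψ y * lam' (ψ y)) _ (e p) at h1
    intro h2
    apply hd'
    rw [h1.fderiv] at h2
    have hJ0 : jacobian ψ (e p) ≠ 0 := jacobian_transition_ne_zero he he' hmem.1 hmem.2
    simp only [Function.comp_apply, hψp, hzero, zero_smul, add_zero, smul_eq_zero, hJ0,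
      false_or] at h2
    -- the derivative of the transition map is onto
    have hsurj : Function.Surjective (fderiv ℝ ψ (e p)) := by
      have h3 : fderiv ℝ ψ (e p) =
          (mfderiv (𝓡 2) (𝓡 2) e' (e.symm (e p))).comp (mfderiv (𝓡 2) (𝓡 2) e.symm (e p)) := by
        rw [← mfderiv_eq_fderiv]
        exact mfderiv_comp _ ((mdifferentiable_of_mem_maximalAtlas he').mdifferentiableAt hmem.2)
          ((mdifferentiable_of_mem_maximalAtlas he).mdifferentiableAt_symm hmem.1)
      rw [h3]
      exact ((mdifferentiable_of_mem_maximalAtlas he').mfderiv_surjective hmem.2).comp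
        ((mdifferentiable_of_mem_maximalAtlas he).symm.mfderiv_surjective hmem.1)
    ext1 v
    obtain ⟨w, rfl⟩ := hsurj v
    exact DFunLike.congr_fun h2 w

end Density

/-! ### Existence of the normal form -/

lemma normalForm_apply (α β : Plane → ℝ) (y a b : Plane) :
    normalForm α β y a b =
      (1 + y 1 ^ 2 * α y) * (a 0 * b 0) + y 1 ^ 2 * (1 + y 1 * β y) * (a 1 * b 1) := rfl

section Existence

/-- The plane as a product. -/
def planeEquiv : Plane ≃L[ℝ] ℝ × ℝ :=
  (EuclideanSpace.equiv (Fin 2) ℝ).trans (ContinuousLinearEquiv.finTwoArrow ℝ ℝ)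

@[simp] lemma planeEquiv_apply (a : Plane) : planeEquiv a = (a 0, a 1) := rfl

lemma exists_equiv_of_cross_ne_zero {L : ℝ × ℝ →L[ℝ] ℝ × ℝ}
    (h : cross (L (1, 0)) (L (0, 1)) ≠ 0) : ∃ L' : (ℝ × ℝ) ≃L[ℝ] ℝ × ℝ, (L' : _ →L[ℝ] _) = L := by
  have hexp : ∀ v : ℝ × ℝ, L v = v.1 • L (1, 0) + v.2 • L (0, 1) := by
    intro v
    rw [← map_smul, ← map_smul, ← map_add]
    simp
  have hinj : Function.Injective L := by
    rw [injective_iff_map_eq_zero]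
    intro v hv
    rw [hexp] at hv
    have h1 := congrArg (fun w => cross w (L (0, 1))) hv
    have h2 := congrArg (fun w => cross (L (1, 0)) w) hv
    simp only [cross, Prod.fst_add, Prod.snd_add, Prod.smul_fst, Prod.smul_snd, smul_eq_mul,
      Prod.fst_zero, Prod.snd_zero] at h1 h2 h
    refine Prod.ext ((mul_eq_zero.1 (?_ : v.1 * _ = 0)).resolve_right h)
      ((mul_eq_zero.1 (?_ : v.2 * _ = 0)).resolve_right h)
    · linear_combination h1
    · linear_combination h2
  have hbij : Function.Bijective L := ⟨hinj, LinearMap.injective_iff_surjective.1 hinj⟩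
  refine ⟨(LinearEquiv.ofBijective (L : ℝ × ℝ →ₗ[ℝ] ℝ × ℝ) hbij).toContinuousLinearEquiv, ?_⟩
  ext1 <;> ext1 <;> rfl

variable {M : Type*} [TopologicalSpace M] [ChartedSpace Plane M] [IsManifold (𝓡 2) ∞ M]

lemma chartForm_eq_firstForm {g : BilinField M} {W : Set M} (hg : IsSemiMetricOn g W)
    (e : OpenPartialHomeomorph M Plane) {y : Plane} (hy : e.symm y ∈ W) (a b : Plane) :
    chartForm g e y a b = firstForm (fun z => coeff g e 0 0 (planeEquiv.symm z))
      (fun z => coeff g e 0 1 (planeEquiv.symm z)) (fun z => coeff g e 1 1 (planeEquiv.symm z))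
      (planeEquiv y) (planeEquiv a) (planeEquiv b) := by
  rw [chartForm_eq, coeff_symm hg e hy]
  simp only [firstForm]
  rw [planeEquiv.symm_apply_apply]
  simp only [planeEquiv_apply]
  ring

/-- A chart for which the singular points near `p` lie on the axis `v = 0`, the coordinate lines
are orthogonal, the axis is parametrized by arc length, and `G` has the form required of it. -/
lemma exists_adapted_chart {W : Set M} {g : BilinField M} {p : M} (hW : IsOpen W) (hpW : p ∈ W)
    (hg : IsSemiMetricOn g W) (hA2 : IsA2Point g p) :
    ∃ e ∈ IsManifold.maximalAtlas (𝓡 2) ∞ M, p ∈ e.source ∧ e.source ⊆ W ∧ e p = 0 ∧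
      (∀ᶠ x in 𝓝 (0 : ℝ), coeff g e 0 0 (planeEquiv.symm (x, 0)) = 1) ∧
      ∃ β : ℝ × ℝ → ℝ, SmoothNear β 0 ∧ ∀ᶠ z in 𝓝 (0 : ℝ × ℝ),
        coeff g e 0 1 (planeEquiv.symm z) = 0 ∧
        coeff g e 1 1 (planeEquiv.symm z) = z.2 ^ 2 * (1 + z.2 * β z) := by
  obtain ⟨hsing, hnd, e, he, hpe, ε, γ, η, hε, hγ, hη, hγ0, hγt, -, hηt, hli⟩ := hA2
  obtain ⟨lam, hlam, hdet, hd⟩ := exists_areaDensity hW hg he hpe hpW hsing hnd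
  have hIoo : Set.Ioo (-ε) ε ∈ 𝓝 (0 : ℝ) := Ioo_mem_nhds (by linarith) hε
  have hWe : e.target ∩ e.symm ⁻¹' W ∈ 𝓝 (e p) :=
    (e.symm.isOpen_inter_preimage hW).mem_nhds
      ⟨e.map_source hpe, by simpa [e.left_inv hpe] using hpW⟩
  have hP : SmoothNear (planeEquiv.symm : ℝ × ℝ → Plane) (planeEquiv (e p)) :=
    .of_contDiff planeEquiv.symm.contDiff _
  have hPP : planeEquiv.symm (planeEquiv (e p)) = e p := planeEquiv.symm_apply_apply _
  have hPt : Filter.Tendsto (planeEquiv.symm : ℝ × ℝ → Plane) (𝓝 (planeEquiv (e p)))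
      (𝓝 (e p)) := planeEquiv.symm.continuous.tendsto' _ _ hPP
  have hc : ∀ i j, SmoothNear (fun z => coeff g e i j (planeEquiv.symm z)) (planeEquiv (e p)) := by
    intro i j
    refine SmoothNear.comp (g := coeff g e i j) ?_ hP
    rw [hPP]
    exact .of_contDiffOn (contDiffOn_coeff hg he i j) hWe
  have hlam' : SmoothNear (fun z => lam (planeEquiv.symm z)) (planeEquiv (e p)) := by
    refine SmoothNear.comp (g := lam) ?_ hP
    rwa [hPP]
  have hγs : SmoothNear γ 0 := .of_contDiffOn hγ hIoo
  have hηs : SmoothNear η 0 := .of_contDiffOn hη hIoo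
  have hγ' : HasDerivAt (fun t => planeEquiv (γ t)) (planeEquiv (deriv γ 0)) 0 :=
    planeEquiv.hasFDerivAt.comp_hasDerivAt 0 hγs.differentiableAt.hasDerivAt
  obtain ⟨Θ, hΘ, hΘ0, hΘcr, hΘE, β, hβ, hΘG⟩ := exists_adapted_coordinates
    (γ := fun t => planeEquiv (γ t)) (η := fun t => planeEquiv (η t))
    (hc 0 0) (hc 0 1) (hc 1 1) hlam'
    (by
      filter_upwards [hPt.eventually hWe] with z hz a
      have h1 := hg.nonneg _ hz.2 (mfderiv (𝓡 2) (𝓡 2) e.symm _ (planeEquiv.symm a : Plane))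
      have h2 := chartForm_eq_firstForm hg e hz.2 (planeEquiv.symm a) (planeEquiv.symm a)
      rw [planeEquiv.apply_symm_apply, planeEquiv.apply_symm_apply] at h2
      rw [← h2]
      exact h1)
    (hPt.eventually hdet)
    (by
      intro h0
      apply hd
      have h1 : lam = fun y => (fun z => lam (planeEquiv.symm z)) (planeEquiv y) := by
        funext y
        simp only [ContinuousLinearEquiv.symm_apply_apply]
      have h2 := hlam'.differentiableAt.hasFDerivAt.comp (e p)
        planeEquiv.hasFDerivAt
      rw [h0, ContinuousLinearMap.zero_comp] at h2
      have h3 : HasFDerivAt lam (0 : Plane →L[ℝ] ℝ) (e p) := by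
        rw [h1]
        exact h2
      exact h3.fderiv)
    (SmoothNear.comp (.of_contDiff planeEquiv.contDiff _) hγs)
    (SmoothNear.comp (.of_contDiff planeEquiv.contDiff _) hηs)
    (by rw [hγ0])
    (by
      have h1 : ∀ᶠ t in 𝓝 (0 : ℝ), γ t ∈ e.target ∩ e.symm ⁻¹' W :=
        hγs.continuousAt.eventually (by rwa [hγ0])
      filter_upwards [h1, hIoo] with t h2 h3 b
      have h4 := chartForm_eq_firstForm hg e h2.2 (η t) (planeEquiv.symm b)
      rw [planeEquiv.apply_symm_apply] at h4
      rw [← h4]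
      exact (hηt t h3).2 _)
    (by
      rw [hγ'.deriv]
      intro h0
      rw [LinearIndependent.pair_iff] at hli
      have h1 : deriv γ 0 0 * η 0 1 - deriv γ 0 1 * η 0 0 = 0 := h0
      have h2 := hli (η 0 1) (-deriv γ 0 1) (by
        ext i
        fin_cases i
        · simp
          linear_combination h1
        · simp
          ring)
      have h3 := hli (η 0 0) (-deriv γ 0 0) (by
        ext i
        fin_cases i
        · simp
          ring
        · simp
          linear_combination -h1)
      apply (hηt 0 ⟨by linarith, hε⟩).1
      rw [plane_eq (η 0), h2.1, h3.1]
      simp)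
  -- the new chart is the old one followed by the inverse of `f`
  let f : Plane → Plane := fun y => planeEquiv.symm (Θ (planeEquiv y))
  have hP0 : planeEquiv 0 = 0 := map_zero _
  have hf0 : f 0 = e p := by
    change planeEquiv.symm (Θ (planeEquiv 0)) = e p
    rw [hP0, hΘ0, hPP]
  have hf : SmoothNear f 0 := by
    refine SmoothNear.comp (g := planeEquiv.symm) (.of_contDiff planeEquiv.symm.contDiff _) ?_
    refine SmoothNear.comp (g := Θ) (f := planeEquiv) ?_ (.of_contDiff planeEquiv.contDiff _)
    rwa [hP0]
  have hfd : ∀ y, DifferentiableAt ℝ Θ (planeEquiv y) → HasFDerivAt f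
      ((planeEquiv.symm : ℝ × ℝ →L[ℝ] Plane).comp ((fderiv ℝ Θ (planeEquiv y)).comp
        (planeEquiv : Plane →L[ℝ] ℝ × ℝ))) y := fun y hy =>
    (planeEquiv.symm.hasFDerivAt).comp y (hy.hasFDerivAt.comp y planeEquiv.hasFDerivAt)
  obtain ⟨L, hL⟩ := exists_equiv_of_cross_ne_zero hΘcr
  have hf' : HasFDerivAt f (((planeEquiv.trans L).trans planeEquiv.symm : Plane ≃L[ℝ] Plane) :
      Plane →L[ℝ] Plane) 0 := by
    have h1 := hfd 0 (by
      rw [hP0]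
      exact hΘ.differentiableAt)
    rw [hP0, ← hL] at h1
    exact h1
  have hft : Filter.Tendsto f (𝓝 0) (𝓝 (e p)) := by
    have := hf.continuousAt.tendsto
    rwa [hf0] at this
  obtain ⟨h, hhf, h0s, hsub, hh, hhsymm⟩ := exists_openPartialHomeomorph hf hf'
    (show f ⁻¹' (e.target ∩ e.symm ⁻¹' W) ∈ 𝓝 0 from hft hWe)
  let e₁ : OpenPartialHomeomorph M Plane := e.trans h.symm
  have he₁ : e₁ ∈ IsManifold.maximalAtlas (𝓡 2) ∞ M := by
    refine e₁.mem_maximalAtlas_of_contMDiffOn ?_ ?_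
    · refine (contMDiffOn_iff_contDiffOn.2 hhsymm).comp
        ((contMDiffOn_of_mem_maximalAtlas he).mono fun x hx => ?_) fun x hx => ?_
      · exact hx.1
      · exact hx.2
    · refine (contMDiffOn_symm_of_mem_maximalAtlas he).comp
        ((contMDiffOn_iff_contDiffOn.2 hh).mono fun y hy => ?_) fun y hy => ?_
      · exact hy.1
      · exact hy.2
  have htarget : ∀ y ∈ h.source, y ∈ e₁.target := by
    intro y hy
    refine ⟨hy, ?_⟩
    change h y ∈ e.target
    rw [hhf]
    exact (hsub hy).1
  have hsymm : ∀ y, e₁.symm y = e.symm (f y) := by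
    intro y
    change e.symm (h y) = _
    rw [hhf]
  have hpt : e p ∈ h.target := by
    rw [← hf0, ← hhf]
    exact h.map_source h0s
  have hcoeff : ∀ᶠ z in 𝓝 (0 : ℝ × ℝ), ∀ a b : Plane,
      chartForm g e₁ (planeEquiv.symm z) a b =
        firstForm (fun z => coeff g e 0 0 (planeEquiv.symm z))
          (fun z => coeff g e 0 1 (planeEquiv.symm z)) (fun z => coeff g e 1 1 (planeEquiv.symm z))
          (Θ z) (fderiv ℝ Θ z (planeEquiv a)) (fderiv ℝ Θ z (planeEquiv b)) := by
    have h1 : Filter.Tendsto (planeEquiv.symm : ℝ × ℝ → Plane) (𝓝 0) (𝓝 0) :=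
      planeEquiv.symm.continuous.tendsto' _ _ (map_zero _)
    filter_upwards [h1.eventually (h.open_source.mem_nhds h0s),
      hΘ.eventually_differentiableAt] with z hz hzd a b
    have h2 : e₁.symm (planeEquiv.symm z) ∈ e.source := by
      rw [hsymm]
      exact e.map_target (hsub hz).1
    have h3 : (fun y => e (e₁.symm y)) =ᶠ[𝓝 (planeEquiv.symm z)] f := by
      filter_upwards [h.open_source.mem_nhds hz] with y hy
      rw [hsymm, e.right_inv (hsub hy).1]
    have h5 : e (e₁.symm (planeEquiv.symm z)) = f (planeEquiv.symm z) := h3.self_of_nhds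
    rw [chartForm_transition g he₁ he (htarget _ hz) h2, h3.fderiv_eq, h5,
      chartForm_eq_firstForm hg e (hsub hz).2]
    have h4 := hfd (planeEquiv.symm z) (by rwa [planeEquiv.apply_symm_apply])
    rw [h4.fderiv]
    simp only [f, ContinuousLinearMap.comp_apply, ContinuousLinearEquiv.coe_coe,
      ContinuousLinearEquiv.apply_symm_apply]
  have hs0 : planeEquiv (EuclideanSpace.single 0 1) = (1, 0) := by simp
  have hs1 : planeEquiv (EuclideanSpace.single 1 1) = (0, 1) := by simp
  have hx0 : Filter.Tendsto (fun x : ℝ => (x, (0 : ℝ))) (𝓝 0) (𝓝 (0 : ℝ × ℝ)) :=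
    (by fun_prop : Continuous fun x : ℝ => (x, (0 : ℝ))).tendsto' _ _ rfl
  refine ⟨e₁, he₁, ⟨hpe, hpt⟩, ?_, ?_, ?_, β, hβ, ?_⟩
  · intro x hx
    have h1 : h.symm (e x) ∈ h.source := h.map_target hx.2
    have h2 := (hsub h1).2
    have h3 : h (h.symm (e x)) = e x := h.right_inv hx.2
    rw [← hhf, h3, Set.mem_preimage, e.left_inv hx.1] at h2
    exact h2
  · change h.symm (e p) = 0
    rw [← hf0, ← hhf]
    exact h.left_inv h0s
  · filter_upwards [hΘE, hx0.eventually hcoeff] with x h1 h2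
    rw [coeff_eq_chartForm, h2, hs0]
    exact h1
  · filter_upwards [hΘG, hcoeff] with z h1 h2
    rw [coeff_eq_chartForm, coeff_eq_chartForm, h2, h2, hs0, hs1]
    exact h1

/-- Existence of the normal form at an `A₂`-point. -/
theorem exists_normalForm_chart [T2Space M] {W : Set M} {g : BilinField M} {p : M} (hW : IsOpen W)
    (hpW : p ∈ W) (hK : IsKossowskiOn g W) (hA2 : IsA2Point g p) :
    ∃ e ∈ IsManifold.maximalAtlas (𝓡 2) ∞ M,
      p ∈ e.source ∧ e.source ⊆ W ∧ e p = 0 ∧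
      ∃ α β : Plane → ℝ, ContDiffOn ℝ ∞ α e.target ∧ ContDiffOn ℝ ∞ β e.target ∧
        ∀ q ∈ e.source, ∀ X Y : TangentSpace (𝓡 2) q,
          g q X Y = normalForm α β (e q)
            (mfderiv (𝓡 2) (𝓡 2) e q X) (mfderiv (𝓡 2) (𝓡 2) e q Y) := by
  have hg : IsSemiMetricOn g W := hK.1.1.1
  obtain ⟨e, he, hpe, heW, hep, hE, β, hβ, hFG⟩ := exists_adapted_chart hW hpW hg hA2
  have hP0 : planeEquiv.symm 0 = 0 := map_zero _
  have hPt : Filter.Tendsto (planeEquiv.symm : ℝ × ℝ → Plane) (𝓝 0) (𝓝 0) :=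
    planeEquiv.symm.continuous.tendsto' _ _ hP0
  have hPt' : Filter.Tendsto (planeEquiv : Plane → ℝ × ℝ) (𝓝 0) (𝓝 0) :=
    planeEquiv.continuous.tendsto' _ _ (map_zero _)
  have hx0 : Filter.Tendsto (fun x : ℝ => (x, (0 : ℝ))) (𝓝 0) (𝓝 (0 : ℝ × ℝ)) :=
    (by fun_prop : Continuous fun x : ℝ => (x, (0 : ℝ))).tendsto' _ _ rfl
  have hfst : Filter.Tendsto (fun z : ℝ × ℝ => z.1) (𝓝 0) (𝓝 0) :=
    continuous_fst.tendsto' _ _ rfl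
  have htarget : e.target ∈ 𝓝 (0 : Plane) := by
    rw [← hep]
    exact e.open_target.mem_nhds (e.map_source hpe)
  have hsm : ∀ i j, ContDiffOn ℝ ∞ (coeff g e i j) e.target := fun i j =>
    (contDiffOn_coeff hg he i j).mono fun y hy => ⟨hy, heW (e.map_target hy)⟩
  have hE' : SmoothNear (fun z => coeff g e 0 0 (planeEquiv.symm z)) 0 := by
    refine SmoothNear.comp (g := coeff g e 0 0) ?_ (.of_contDiff planeEquiv.symm.contDiff _)
    rw [hP0]
    exact .of_contDiffOn (hsm 0 0) htarget
  obtain ⟨ε, hε, hEε, hεd⟩ := exists_smoothNear_eq_add_mul hE'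
  obtain ⟨α, hα, hεα, -⟩ := exists_smoothNear_eq_add_mul hε
  -- admissibility along the axis: there `F` vanishes identically and hence `E_v = 2 F_u = 0`
  have hε0 : ∀ᶠ x in 𝓝 (0 : ℝ), ε (x, 0) = 0 := by
    have hF : ∀ᶠ y in 𝓝 (0 : Plane), coeff g e 0 1 y = 0 := by
      filter_upwards [hPt'.eventually hFG] with y hy
      simpa only [ContinuousLinearEquiv.symm_apply_apply] using hy.1
    filter_upwards [hεd, hx0.eventually hFG, (hPt.comp hx0).eventually htarget,
      (hPt.comp hx0).eventually hF.eventually_nhds] with x h1 h2 h3 h4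
    simp only [Function.comp_apply] at h3 h4
    set y : Plane := planeEquiv.symm (x, 0) with hy
    have hyW : e.symm y ∈ W := heW (e.map_target h3)
    have hnull : ∀ b, chartForm g e y (EuclideanSpace.single 1 1) b = 0 := by
      intro b
      rw [chartForm_eq, coeff_symm hg e hyW, h2.1, h2.2]
      simp
    have hs : IsSingular g (e.symm y) := by
      intro hpos
      have h5 : (EuclideanSpace.single 1 1 : Plane) ≠ 0 := by simp
      have h6 : mfderiv (𝓡 2) (𝓡 2) e.symm y (EuclideanSpace.single 1 (1 : ℝ) : Plane) ≠ 0 := by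
        intro h7
        apply h5
        apply (mdifferentiable_of_mem_maximalAtlas he).symm.mfderiv_injective h3
        exact h7.trans (map_zero (mfderiv (𝓡 2) (𝓡 2) e.symm y)).symm
      exact (hpos _ h6).ne' (hnull (EuclideanSpace.single 1 1))
    have h5 := fderiv_coeff_of_isAdmissibleAt hW hg he (e.map_target h3) hyW
      (hK.1.1.2 _ hyW hs) (by
        rw [e.right_inv h3]
        exact hnull)
    rw [e.right_inv h3] at h5
    have h6 : fderiv ℝ (coeff g e 0 1) y = 0 := by
      rw [Filter.EventuallyEq.fderiv_eq (f := fun _ => (0 : ℝ)) h4]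
      simp
    rw [h6, _root_.zero_apply, mul_zero] at h5
    have h7 : HasDerivAt (fun v : ℝ => planeEquiv.symm (x, v))
        (planeEquiv.symm ((0 : ℝ), (1 : ℝ))) 0 :=
      planeEquiv.symm.hasFDerivAt.comp_hasDerivAt 0
        ((hasDerivAt_const 0 x).prodMk (hasDerivAt_id 0))
    have h8 := (((hsm 0 0).contDiffAt (e.open_target.mem_nhds h3)).differentiableAt
      (by simp)).hasFDerivAt.comp_hasDerivAt 0 h7
    have h9 : planeEquiv.symm ((0 : ℝ), (1 : ℝ)) = EuclideanSpace.single 1 1 := by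
      rw [planeEquiv.symm_apply_eq]
      simp
    rw [h9, h5] at h8
    exact h1.unique h8
  -- everything holds on a neighbourhood `V` of the origin, to which the chart is restricted
  have hall : ∀ᶠ z in 𝓝 (0 : ℝ × ℝ), coeff g e 0 0 (planeEquiv.symm z) = 1 + z.2 ^ 2 * α z ∧
      coeff g e 0 1 (planeEquiv.symm z) = 0 ∧
      coeff g e 1 1 (planeEquiv.symm z) = z.2 ^ 2 * (1 + z.2 * β z) ∧
      ContDiffAt ℝ ∞ α z ∧ ContDiffAt ℝ ∞ β z := by
    filter_upwards [hFG, hEε, hεα, hfst.eventually hE, hfst.eventually hε0, hα, hβ]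
      with z h1 h2 h3 h4 h5 h6 h7
    refine ⟨?_, h1.1, h1.2, h6, h7⟩
    rw [h2, h3, h4, h5]
    ring
  obtain ⟨V, hV, hVo, hV0⟩ := eventually_nhds_iff.1 (hPt'.eventually hall)
  let e₂ : OpenPartialHomeomorph M Plane :=
    e.restrOpen (e.source ∩ e ⁻¹' V) (e.isOpen_inter_preimage hVo)
  have hsrc : ∀ x ∈ e₂.source, x ∈ e.source ∧ e x ∈ V := fun x hx => ⟨hx.1, hx.2.2⟩
  have htgt : ∀ y ∈ e₂.target, y ∈ e.target ∧ y ∈ V := by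
    intro y hy
    have h1 : e₂ (e₂.symm y) = y := e₂.right_inv hy
    have h2 := hsrc _ (e₂.map_target hy)
    change e (e₂.symm y) = y at h1
    rw [h1] at h2
    exact ⟨h1 ▸ e.map_source h2.1, h2.2⟩
  refine ⟨e₂, ?_, ⟨hpe, hpe, ?_⟩, fun x hx => heW (hsrc x hx).1, hep,
    fun y => α (planeEquiv y), fun y => β (planeEquiv y), ?_, ?_, ?_⟩
  · exact e₂.mem_maximalAtlas_of_contMDiffOn
      ((contMDiffOn_of_mem_maximalAtlas he).mono fun x hx => (hsrc x hx).1)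
      ((contMDiffOn_symm_of_mem_maximalAtlas he).mono fun y hy => (htgt y hy).1)
  · rw [Set.mem_preimage, hep]
    exact hV0
  · intro y hy
    exact ((hV y (htgt y hy).2).2.2.2.1.comp y planeEquiv.contDiff.contDiffAt).contDiffWithinAt
  · intro y hy
    exact ((hV y (htgt y hy).2).2.2.2.2.comp y planeEquiv.contDiff.contDiffAt).contDiffWithinAt
  · intro q hq X Y
    obtain ⟨hqe, hqV⟩ := hsrc q hq
    obtain ⟨h1, h2, h3, -, -⟩ := hV _ hqV
    simp only [ContinuousLinearEquiv.symm_apply_apply] at h1 h2 h3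
    have h4 : coeff g e 1 0 (e q) = 0 := by
      rw [coeff_symm hg e (by
        rw [e.left_inv hqe]
        exact heW hqe), h2]
    refine (eq_chartForm he hqe X Y).trans ((chartForm_eq g e _ _ _).trans ?_)
    rw [h1, h2, h3, h4]
    refine Eq.trans ?_ (normalForm_apply _ _ _ _ _).symm
    change _ = (1 + e q 1 ^ 2 * α (planeEquiv (e q))) * _
      + e q 1 ^ 2 * (1 + e q 1 * β (planeEquiv (e q))) * _
    simp only [zero_mul, add_zero]
    rfl

end Existence

/-! ### The normal form is a Kossowski metric -/

section Converse

lemma trivializationAt_covector_apply (x y : Plane) (f : TangentSpace (𝓡 2) y →L[ℝ] ℝ) :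
    (trivializationAt (Plane →L[ℝ] ℝ)
      (fun y : Plane => TangentSpace (𝓡 2) y →L[ℝ] Bundle.Trivial Plane ℝ y) x ⟨y, f⟩).2 = f := by
  rw [hom_trivializationAt_apply]
  ext w
  simp [ContinuousLinearMap.inCoordinates]
  rfl

/-- The bundle of bilinear forms on the plane is trivialized by the identity. -/
lemma trivializationAt_bilinForm_apply (x y : Plane)
    (B : TangentSpace (𝓡 2) y →L[ℝ] TangentSpace (𝓡 2) y →L[ℝ] ℝ) :
    (trivializationAt (Plane →L[ℝ] Plane →L[ℝ] ℝ)
      (fun y : Plane => TangentSpace (𝓡 2) y →L[ℝ] TangentSpace (𝓡 2) y →L[ℝ] ℝ) x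
      ⟨y, B⟩).2 = B := by
  rw [hom_trivializationAt_apply]
  ext v w
  simp only [ContinuousLinearMap.inCoordinates]
  simp
  rw [Bundle.Trivialization.coe_linearMapAt_of_mem]
  · exact congrArg (fun L => L w) (trivializationAt_covector_apply x y (B v))
  · simp only [hom_trivializationAt_baseSet]
    exact ⟨Set.mem_univ y, Set.mem_univ y⟩

lemma contMDiffOn_bilinField {B : BilinField Plane} {s : Set Plane}
    (hB : ContDiffOn ℝ (E := Plane) (F := Plane →L[ℝ] Plane →L[ℝ] ℝ) ∞ B s) :
    ContMDiffOn (𝓡 2) ((𝓡 2).prod 𝓘(ℝ, Plane →L[ℝ] Plane →L[ℝ] ℝ)) ∞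
      (fun x : Plane => Bundle.TotalSpace.mk' (Plane →L[ℝ] Plane →L[ℝ] ℝ)
        (E := fun y : Plane => TangentSpace (𝓡 2) y →L[ℝ] TangentSpace (𝓡 2) y →L[ℝ] ℝ) x (B x))
      s := by
  intro x hx
  rw [Bundle.contMDiffWithinAt_section]
  refine (contMDiffOn_iff_contDiffOn.2 hB x hx).congr_of_eventuallyEq
    (Filter.Eventually.of_forall fun y => ?_) ?_
  · exact trivializationAt_bilinForm_apply x y (B y)
  · exact trivializationAt_bilinForm_apply x x (B x)

lemma refl_mem_maximalAtlas :
    OpenPartialHomeomorph.refl Plane ∈ IsManifold.maximalAtlas (𝓡 2) ∞ Plane :=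
  IsManifold.subset_maximalAtlas (by simp)

lemma chartForm_refl (g : BilinField Plane) (y a b : Plane) :
    chartForm g (OpenPartialHomeomorph.refl Plane) y a b = g y a b := by
  have h1 : mfderiv (𝓡 2) (𝓡 2) (OpenPartialHomeomorph.refl Plane).symm y =
      ContinuousLinearMap.id ℝ (TangentSpace (𝓡 2) y) := mfderiv_id
  rw [chartForm, h1]
  rfl

variable {α β : Plane → ℝ}

lemma coeff_normalForm (y : Plane) :
    coeff (normalForm α β) (OpenPartialHomeomorph.refl Plane) 0 0 y = 1 + y 1 ^ 2 * α y ∧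
    coeff (normalForm α β) (OpenPartialHomeomorph.refl Plane) 0 1 y = 0 ∧
    coeff (normalForm α β) (OpenPartialHomeomorph.refl Plane) 1 1 y =
      y 1 ^ 2 * (1 + y 1 * β y) := by
  simp only [coeff_eq_chartForm, chartForm_refl, normalForm_apply]
  simp

lemma isSingular_normalForm_iff {y : Plane} (hα : 0 < 1 + y 1 ^ 2 * α y)
    (hβ : 0 < 1 + y 1 * β y) : IsSingular (normalForm α β) y ↔ y 1 = 0 := by
  rw [IsSingular, not_iff_comm]
  constructor
  · intro hy (a : Plane) ha
    refine lt_of_lt_of_eq ?_ (normalForm_apply α β y a a).symm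
    by_cases h0 : a 0 = 0
    · have h1 : a 1 ≠ 0 := by
        intro h1
        have h2 : a = (0 : Plane) := by
          ext i
          fin_cases i
          · exact h0
          · exact h1
        exact ha h2
      rw [h0]
      have h2 : 0 < a 1 * a 1 := mul_self_pos.2 h1
      have : 0 < y 1 ^ 2 * (1 + y 1 * β y) * (a 1 * a 1) := by positivity
      simpa using this
    · have h1 : 0 < (1 + y 1 ^ 2 * α y) * (a 0 * a 0) :=
        mul_pos hα (mul_self_pos.2 h0)
      have h2 : 0 ≤ y 1 ^ 2 * (1 + y 1 * β y) * (a 1 * a 1) :=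
        mul_nonneg (by positivity) (mul_self_nonneg _)
      exact add_pos_of_pos_of_nonneg h1 h2
  · intro h hy
    have h1 : (0 : ℝ) < normalForm α β y (EuclideanSpace.single 1 1 : Plane)
      (EuclideanSpace.single 1 1 : Plane) := h _ (by
        intro h0
        have h2 : (EuclideanSpace.single 1 1 : Plane) 1 = (0 : Plane) 1 :=
          congrArg (fun a : Plane => a 1) h0
        simp at h2)
    rw [normalForm_apply, hy] at h1
    simp at h1

lemma hasFDerivAt_sq_mul {φ : Plane → ℝ} {y : Plane} (hφ : DifferentiableAt ℝ φ y)
    (hy : y 1 = 0) : HasFDerivAt (fun x : Plane => x 1 ^ 2 * φ x) (0 : Plane →L[ℝ] ℝ) y := by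
  have h1 : HasFDerivAt (fun x : Plane => x 1) (coordForm 1) y := (coordForm 1).hasFDerivAt
  refine ((h1.pow 2).mul hφ.hasFDerivAt).congr_fderiv ?_
  simp [hy]

/-- To first order along the axis `v = 0`, the normal form is `du²`. -/
lemma fderiv_normalForm {X Y : Plane → Plane} {y : Plane} (hα : DifferentiableAt ℝ α y)
    (hβ : DifferentiableAt ℝ β y) (hX : DifferentiableAt ℝ X y) (hY : DifferentiableAt ℝ Y y)
    (hy : y 1 = 0) (w : Plane) :
    fderiv ℝ (fun x => (normalForm α β x (X x) (Y x) : ℝ)) y w =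
      fderiv ℝ X y w 0 * Y y 0 + X y 0 * fderiv ℝ Y y w 0 := by
  have hc : ∀ (i : Fin 2) {Z : Plane → Plane}, DifferentiableAt ℝ Z y →
      HasFDerivAt (fun x => Z x i) ((coordForm i).comp (fderiv ℝ Z y)) y := fun i Z hZ =>
    (coordForm i).hasFDerivAt.comp y hZ.hasFDerivAt
  have h1 : HasFDerivAt (fun x : Plane => x 1) (coordForm 1) y := (coordForm 1).hasFDerivAt
  have hB : DifferentiableAt ℝ (fun x : Plane => 1 + x 1 * β x) y :=
    (h1.differentiableAt.mul hβ).const_add 1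
  have h2 := (((hasFDerivAt_sq_mul hα hy).const_add 1).mul ((hc 0 hX).mul (hc 0 hY))).add
    ((hasFDerivAt_sq_mul hB hy).mul ((hc 1 hX).mul (hc 1 hY)))
  have h3 := congrArg (fun L : Plane →L[ℝ] ℝ => L w) h2.fderiv
  refine Eq.trans h3 ?_
  simp [hy, coordForm]
  ring

lemma isAdmissibleAt_normalForm {W : Set Plane} (hW : IsOpen W) {y : Plane} (hyW : y ∈ W)
    (hα : DifferentiableAt ℝ α y) (hβ : DifferentiableAt ℝ β y) (hy : y 1 = 0) :
    IsAdmissibleAt (normalForm α β) W y := by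
  intro X Y Z hX hY hZ hnull
  have hd : ∀ {V : Plane → Plane}, IsVectorFieldOn (M := Plane) V W → DifferentiableAt ℝ V y :=
    fun hV => ((contMDiffOn_vectorSpace_iff_contDiffOn.1 hV).contDiffAt
      (hW.mem_nhds hyW)).differentiableAt (by simp)
  -- from here on the vector fields are functions with values in the plane
  change Plane → Plane at X Y Z
  have hZ0 : Z y 0 = 0 := by
    have h1 := (normalForm_apply α β y (Z y) (EuclideanSpace.single 0 1)).symm.trans (hnull _)
    rw [hy] at h1
    simpa using h1
  have hD : ∀ {V V' : Plane → Plane} (U : Plane → Plane), DifferentiableAt ℝ V y →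
      DifferentiableAt ℝ V' y →
      dirDeriv (M := Plane) U (fun x => normalForm α β x (V x) (V' x)) y =
        fderiv ℝ V y (U y) 0 * V' y 0 + V y 0 * fderiv ℝ V' y (U y) 0 := by
    intro V V' U hV hV'
    refine (congrArg (fun L : Plane →L[ℝ] ℝ => L (U y)) mfderiv_eq_fderiv).trans ?_
    exact fderiv_normalForm hα hβ hV hV' hy (U y)
  have hB : ∀ (V V' : Plane → Plane) (a : Plane),
      (normalForm α β y (VectorField.mlieBracket (M := Plane) (𝓡 2) V V' y) a : ℝ) =
        (fderiv ℝ V' y (V y) 0 - fderiv ℝ V y (V' y) 0) * a 0 := by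
    intro V V' a
    refine (normalForm_apply α β y (VectorField.mlieBracket (M := Plane) (𝓡 2) V V' y) a).trans ?_
    have h1 : VectorField.mlieBracket (M := Plane) (𝓡 2) V V' y =
        fderiv ℝ V' y (V y) - fderiv ℝ V y (V' y) := congrFun (mlieBracket_eq_lieBracket V V') y
    rw [hy, h1]
    simp
  change (1 / 2 : ℝ) *
    (dirDeriv (M := Plane) X (fun x => normalForm α β x (Y x) (Z x)) y
      + dirDeriv (M := Plane) Y (fun x => normalForm α β x (X x) (Z x)) y
      - dirDeriv (M := Plane) Z (fun x => normalForm α β x (X x) (Y x)) y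
      + normalForm α β y (VectorField.mlieBracket (M := Plane) (𝓡 2) X Y y) (Z y)
      - normalForm α β y (VectorField.mlieBracket (M := Plane) (𝓡 2) X Z y) (Y y)
      - normalForm α β y (VectorField.mlieBracket (M := Plane) (𝓡 2) Y Z y) (X y)) = 0
  rw [hD (V := Y) (V' := Z) X (hd hY) (hd hZ),
    hD (V := X) (V' := Z) Y (hd hX) (hd hZ), hD (V := X) (V' := Y) Z (hd hX) (hd hY),
    hB X Y (Z y), hB X Z (Y y), hB Y Z (X y), hZ0]
  ring

/-- `v √((1 + v² α) (1 + v β))`, the signed area density of the normal form. -/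
def normalDensity (α β : Plane → ℝ) (y : Plane) : ℝ :=
  y 1 * √((1 + y 1 ^ 2 * α y) * (1 + y 1 * β y))

lemma normalDensity_sq {y : Plane} (hα : 0 < 1 + y 1 ^ 2 * α y) (hβ : 0 < 1 + y 1 * β y) :
    coeff (normalForm α β) (OpenPartialHomeomorph.refl Plane) 0 0 y *
        coeff (normalForm α β) (OpenPartialHomeomorph.refl Plane) 1 1 y -
      coeff (normalForm α β) (OpenPartialHomeomorph.refl Plane) 0 1 y ^ 2 =
    normalDensity α β y ^ 2 := by
  obtain ⟨h1, h2, h3⟩ := coeff_normalForm (α := α) (β := β) y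
  rw [h1, h2, h3, normalDensity, mul_pow, Real.sq_sqrt (mul_pos hα hβ).le]
  ring

lemma contDiffOn_coord (i : Fin 2) (s : Set Plane) : ContDiffOn ℝ ∞ (fun x : Plane => x i) s :=
  (coordForm i).contDiff.contDiffOn

lemma contDiffOn_normalDensity {W : Set Plane} (hα : ContDiffOn ℝ ∞ α W)
    (hβ : ContDiffOn ℝ ∞ β W) (hE : ∀ y ∈ W, 0 < 1 + y 1 ^ 2 * α y)
    (hG : ∀ y ∈ W, 0 < 1 + y 1 * β y) : ContDiffOn ℝ ∞ (normalDensity α β) W := by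
  have hv := contDiffOn_coord 1 W
  exact hv.mul (((contDiffOn_const.add ((hv.pow 2).mul hα)).mul
    (contDiffOn_const.add (hv.mul hβ))).sqrt fun y hy => (mul_pos (hE y hy) (hG y hy)).ne')

lemma fderiv_normalDensity_ne_zero {y : Plane} (hα : ContDiffAt ℝ ∞ α y)
    (hβ : ContDiffAt ℝ ∞ β y) (hy : y 1 = 0) : fderiv ℝ (normalDensity α β) y ≠ 0 := by
  have h1 : HasFDerivAt (fun x : Plane => x 1) (coordForm 1) y := (coordForm 1).hasFDerivAt
  have hv : ContDiffAt ℝ ∞ (fun x : Plane => x 1) y := (coordForm 1).contDiff.contDiffAt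
  have h2 : ContDiffAt ℝ ∞
      (fun x : Plane => √((1 + x 1 ^ 2 * α x) * (1 + x 1 * β x))) y :=
    ((contDiffAt_const.add ((hv.pow 2).mul hα)).mul (contDiffAt_const.add (hv.mul hβ))).sqrt
      (by simp [hy])
  have h3 := h1.mul (h2.differentiableAt (by simp)).hasFDerivAt
  intro h0
  have h4 := congrArg (fun L : Plane →L[ℝ] ℝ => L (EuclideanSpace.single 1 1))
    (h3.fderiv.symm.trans h0)
  simp [hy, coordForm] at h4

lemma contDiffOn_smul_vector {F : Type*} [NormedAddCommGroup F] [NormedSpace ℝ F]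
    {φ : Plane → ℝ} {s : Set Plane} (h : ContDiffOn ℝ ∞ φ s) (c : F) :
    ContDiffOn ℝ ∞ (fun x => φ x • c) s :=
  h.smul contDiffOn_const

lemma isSemiMetricOn_normalForm {W : Set Plane} (hα : ContDiffOn ℝ ∞ α W)
    (hβ : ContDiffOn ℝ ∞ β W) (hE : ∀ y ∈ W, 0 < 1 + y 1 ^ 2 * α y)
    (hG : ∀ y ∈ W, 0 < 1 + y 1 * β y) : IsSemiMetricOn (normalForm α β) W where
  smooth := by
    have hv : ContDiffOn ℝ ∞ (fun x : Plane => x 1) W := contDiffOn_coord 1 W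
    have hu : ContDiffOn ℝ ∞ (fun x : Plane => 1 + x 1 ^ 2 * α x) W :=
      contDiffOn_const.add ((hv.pow 2).mul hα)
    have hw : ContDiffOn ℝ ∞ (fun x : Plane => x 1 ^ 2 * (1 + x 1 * β x)) W :=
      (hv.pow 2).mul (contDiffOn_const.add (hv.mul hβ))
    have hB : ContDiffOn ℝ ∞ (fun x : Plane =>
        ((1 + x 1 ^ 2 * α x) • (coordForm 0).smulRight (coordForm 0) +
          (x 1 ^ 2 * (1 + x 1 * β x)) • (coordForm 1).smulRight (coordForm 1) :
            Plane →L[ℝ] Plane →L[ℝ] ℝ)) W :=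
      (contDiffOn_smul_vector hu _).add (contDiffOn_smul_vector hw _)
    exact contMDiffOn_bilinField hB
  symm y hy a b := by
    refine (normalForm_apply α β y a b).trans (Eq.trans ?_ (normalForm_apply α β y b a).symm)
    ring
  nonneg y hy a := by
    refine le_of_le_of_eq ?_ (normalForm_apply α β y a a).symm
    have := hE y hy
    have := hG y hy
    exact add_nonneg (mul_nonneg (by positivity) (mul_self_nonneg _))
      (mul_nonneg (by positivity) (mul_self_nonneg _))

lemma isNondegenerateAt_normalForm {W : Set Plane} (hW : IsOpen W) (hα : ContDiffOn ℝ ∞ α W)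
    (hβ : ContDiffOn ℝ ∞ β W) (hE : ∀ y ∈ W, 0 < 1 + y 1 ^ 2 * α y)
    (hG : ∀ y ∈ W, 0 < 1 + y 1 * β y) {y : Plane} (hyW : y ∈ W) (hy : y 1 = 0) :
    IsNondegenerateAt (normalForm α β) y :=
  ⟨_, refl_mem_maximalAtlas, trivial, W, hW, hyW, Set.subset_univ _, normalDensity α β,
    ⟨contDiffOn_normalDensity hα hβ hE hG, fun x hx => normalDensity_sq (hE x hx) (hG x hx)⟩,
    fderiv_normalDensity_ne_zero (hα.contDiffAt (hW.mem_nhds hyW))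
      (hβ.contDiffAt (hW.mem_nhds hyW)) hy⟩

theorem isKossowskiOn_normalForm {W : Set Plane} (hW : IsOpen W) (hα : ContDiffOn ℝ ∞ α W)
    (hβ : ContDiffOn ℝ ∞ β W) (hE : ∀ y ∈ W, 0 < 1 + y 1 ^ 2 * α y)
    (hG : ∀ y ∈ W, 0 < 1 + y 1 * β y) : IsKossowskiOn (normalForm α β) W := by
  have hg := isSemiMetricOn_normalForm hα hβ hE hG
  have hs : ∀ y ∈ W, IsSingular (normalForm α β) y → y 1 = 0 := fun y hy =>
    (isSingular_normalForm_iff (hE y hy) (hG y hy)).1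
  have hd : ∀ {φ : Plane → ℝ}, ContDiffOn ℝ ∞ φ W → ∀ y ∈ W, DifferentiableAt ℝ φ y :=
    fun h y hy => (h.contDiffAt (hW.mem_nhds hy)).differentiableAt (by simp)
  refine ⟨⟨⟨hg, fun y hy hsy => isAdmissibleAt_normalForm hW hy (hd hα y hy) (hd hβ y hy)
    (hs y hy hsy)⟩, ?_⟩, fun y hy hsy => isNondegenerateAt_normalForm hW hα hβ hE hG hy
    (hs y hy hsy)⟩
  intro e he p hp
  -- the area density of the standard chart, multiplied by the Jacobian of the change of chart
  have hV : IsOpen (e.target ∩ e.symm ⁻¹' W) := e.symm.isOpen_inter_preimage hW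
  have hsm : ContDiffOn ℝ ∞ e.symm (e.target ∩ e.symm ⁻¹' W) :=
    (contMDiffOn_iff_contDiffOn.1 (contMDiffOn_symm_of_mem_maximalAtlas he)).mono
      Set.inter_subset_left
  refine ⟨_, hV, ⟨e.map_source hp.1, ?_⟩, Set.inter_subset_left,
    fun y => jacobian e.symm y * normalDensity α β (e.symm y),
    (contDiffOn_jacobian hV hsm).mul
      ((contDiffOn_normalDensity hα hβ hE hG).comp hsm fun y hy => hy.2), fun y hy => ?_⟩
  · rw [Set.mem_preimage, e.left_inv hp.1]
    exact hp.2
  · have h1 := normalDensity_sq (hE _ hy.2) (hG _ hy.2)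
    rw [mul_pow, ← h1]
    exact gram_transition hg he refl_mem_maximalAtlas hy.1 trivial hy.2

/-- The singular curve is the `u`-axis and the null field along it is `∂/∂v`. -/
theorem isA2Point_normalForm {W : Set Plane} (hW : IsOpen W) (h0 : (0 : Plane) ∈ W)
    (hα : ContDiffOn ℝ ∞ α W) (hβ : ContDiffOn ℝ ∞ β W)
    (hE : ∀ y ∈ W, 0 < 1 + y 1 ^ 2 * α y) (hG : ∀ y ∈ W, 0 < 1 + y 1 * β y) :
    IsA2Point (normalForm α β) 0 := by
  have hs : ∀ y ∈ W, IsSingular (normalForm α β) y ↔ y 1 = 0 := fun y hy =>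
    isSingular_normalForm_iff (hE y hy) (hG y hy)
  have hline : ∀ t : ℝ, EuclideanSpace.single 0 t = t • (EuclideanSpace.single 0 1 : Plane) := by
    intro t
    ext i
    fin_cases i <;> simp
  have hγ : ContDiff ℝ ∞ fun t : ℝ => (EuclideanSpace.single 0 t : Plane) := by
    rw [funext hline]
    exact contDiff_id.smul contDiff_const
  have hγ' : ∀ t : ℝ, deriv (fun t : ℝ => (EuclideanSpace.single 0 t : Plane)) t =
      EuclideanSpace.single 0 1 := by
    intro t
    rw [funext hline]
    simpa using ((hasDerivAt_id t).smul_const (EuclideanSpace.single 0 1 : Plane)).deriv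
  obtain ⟨ε, hε, hεW⟩ := Metric.isOpen_iff.1 hW 0 h0
  have hmem : ∀ t ∈ Set.Ioo (-ε) ε, (EuclideanSpace.single 0 t : Plane) ∈ W := by
    intro t ht
    apply hεW
    rw [mem_ball_zero_iff, PiLp.norm_single]
    exact abs_lt.2 ht
  refine ⟨(hs 0 h0).2 rfl, isNondegenerateAt_normalForm hW hα hβ hE hG h0 rfl, _,
    refl_mem_maximalAtlas, trivial, ε, fun t => EuclideanSpace.single 0 t,
    fun _ => EuclideanSpace.single 1 1, hε, hγ.contDiffOn, contDiffOn_const, ?_, ?_, ?_, ?_, ?_⟩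
  · ext i
    fin_cases i <;> simp
  · intro t ht
    refine ⟨trivial, (hs _ (hmem t ht)).2 (by simp), ?_⟩
    rw [hγ']
    simp
  · filter_upwards [Metric.ball_mem_nhds (0 : Plane) hε] with y hy hsy
    have hy1 : y 1 = 0 := (hs y (hεW hy)).1 hsy
    have hy0 : (EuclideanSpace.single 0 (y 0) : Plane) = y := by
      ext i
      fin_cases i
      · simp
      · simpa using hy1.symm
    refine ⟨y 0, abs_lt.1 ?_, hy0⟩
    rw [mem_ball_zero_iff, ← hy0, PiLp.norm_single] at hy
    exact hy
  · intro t ht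
    refine ⟨by simp, fun b => ?_⟩
    have h1 : mfderiv (𝓡 2) (𝓡 2) (OpenPartialHomeomorph.refl Plane).symm
        (EuclideanSpace.single 0 t : Plane) = ContinuousLinearMap.id ℝ _ := mfderiv_id
    rw [h1]
    refine (normalForm_apply α β (EuclideanSpace.single 0 t) (EuclideanSpace.single 1 1) b).trans ?_
    simp
  · rw [LinearIndependent.pair_iff]
    intro a b hab
    rw [hγ'] at hab
    have h1 := congrArg (fun c : Plane => c 0) hab
    have h2 := congrArg (fun c : Plane => c 1) hab
    exact ⟨by simpa using h1, by simpa using h2⟩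

theorem exists_isKossowskiOn_normalForm {U : Set Plane} (hU : IsOpen U) (h0 : (0 : Plane) ∈ U)
    (hα : ContDiffOn ℝ ∞ α U) (hβ : ContDiffOn ℝ ∞ β U) :
    ∃ W : Set Plane, IsOpen W ∧ (0 : Plane) ∈ W ∧ W ⊆ U ∧
      IsKossowskiOn (normalForm α β) W ∧ IsA2Point (normalForm α β) 0 := by
  have hv := contDiffOn_coord 1 U
  have hE : ContDiffOn ℝ ∞ (fun x : Plane => 1 + x 1 ^ 2 * α x) U :=
    contDiffOn_const.add ((hv.pow 2).mul hα)
  have hG : ContDiffOn ℝ ∞ (fun x : Plane => 1 + x 1 * β x) U :=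
    contDiffOn_const.add (hv.mul hβ)
  have h1 := hE.continuousOn.isOpen_inter_preimage hU (isOpen_Ioi (a := 0))
  have h2 := hG.continuousOn.isOpen_inter_preimage hU (isOpen_Ioi (a := 0))
  have hsub := (Set.inter_subset_left.trans Set.inter_subset_left :
    (U ∩ (fun x : Plane => 1 + x 1 ^ 2 * α x) ⁻¹' Set.Ioi 0) ∩
      (U ∩ (fun x : Plane => 1 + x 1 * β x) ⁻¹' Set.Ioi 0) ⊆ U)
  have h0W : (0 : Plane) ∈ (U ∩ (fun x : Plane => 1 + x 1 ^ 2 * α x) ⁻¹' Set.Ioi 0) ∩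
      (U ∩ (fun x : Plane => 1 + x 1 * β x) ⁻¹' Set.Ioi 0) :=
    ⟨⟨h0, by simp⟩, ⟨h0, by simp⟩⟩
  exact ⟨_, h1.inter h2, h0W, hsub,
    isKossowskiOn_normalForm (h1.inter h2) (hα.mono hsub) (hβ.mono hsub)
      (fun y hy => hy.1.2) fun y hy => hy.2.2,
    isA2Point_normalForm (h1.inter h2) h0W (hα.mono hsub) (hβ.mono hsub)
      (fun y hy => hy.1.2) fun y hy => hy.2.2⟩

end Converse

end Kossowski

theorem mainTheorem10 :
    (∀ (M : Type*) [TopologicalSpace M] [T2Space M] [ChartedSpace Plane M]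
        [IsManifold (𝓡 2) ∞ M] (W : Set M) (g : Kossowski.BilinField M) (p : M),
        IsOpen W → p ∈ W → Kossowski.IsKossowskiOn g W → Kossowski.IsA2Point g p →
          ∃ e ∈ IsManifold.maximalAtlas (𝓡 2) ∞ M,
            p ∈ e.source ∧ e.source ⊆ W ∧ e p = 0 ∧
            ∃ α β : Plane → ℝ, ContDiffOn ℝ ∞ α e.target ∧ ContDiffOn ℝ ∞ β e.target ∧
              ∀ q ∈ e.source, ∀ X Y : TangentSpace (𝓡 2) q,
                g q X Y = Kossowski.normalForm α β (e q)
                  (mfderiv (𝓡 2) (𝓡 2) e q X) (mfderiv (𝓡 2) (𝓡 2) e q Y)) ∧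
    (∀ (U : Set Plane) (α β : Plane → ℝ), IsOpen U → (0 : Plane) ∈ U →
        ContDiffOn ℝ ∞ α U → ContDiffOn ℝ ∞ β U →
          ∃ W : Set Plane, IsOpen W ∧ (0 : Plane) ∈ W ∧ W ⊆ U ∧
            Kossowski.IsKossowskiOn (Kossowski.normalForm α β) W ∧
            Kossowski.IsA2Point (Kossowski.normalForm α β) 0) :=
  ⟨fun _ _ _ _ _ _ _ _ hW hpW hK hA2 => Kossowski.exists_normalForm_chart hW hpW hK hA2,
    fun _ _ _ hU h0 hα hβ => Kossowski.exists_isKossowskiOn_normalForm hU h0 hα hβ⟩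

end
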